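/- Let $\mathbb{H}^2$ be the hyperbolic plane of curvature $-1$, oriented, and let $K\subset\mathbb{H}^2$ be a convex body, that is, a nonempty compact geodesically convex set. Its perimeter $\mathcal{P}$ is the length of its boundary curve, i.e. the supremum of the lengths of the closed polygons inscribed in $\partial K$ with vertices in cyclic order (so a segment, as a two-gon, has perimeter twice its length, and a point has perimeter $0$). Fix a point $O\in\mathbb{H}^2$ and a direction at $O$. For an angle $\varphi$, measured counterclockwise at $O$ from the fixed direction, let $R=R(\varphi)$ be the ideal point of the ray from $O$ with central angle $\varphi$. Consider the right-hand support line of $K$ through $R$ as viewed from $R$, that is, the line through $R$ that meets $K$ and, when oriented away from $R$, has $K$ on its (closed) left side. Let $r$ be the signed hyperbolic distance from $O$ to this line, nonnegative if $O$ lies on the line or on the same side of it as $K$, and negative otherwise. Let $P\in K$ be a point of contact of this line with $K$, let $\rho$ be the hyperbolic distance from $O$ to $P$, and let $\alpha$ be the hyperbolic angle at $P$ from the radial direction (pointing away from $O$) to the outward normal, that is, the normal of the support line pointing to its right, away from $K$ (if $P=O$, then $\alpha$ is arbitrary). Then the support line and a contact point exist for every $\varphi$, $\mathcal{P}$ is finite,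 and for every choice of the contact points (and of $\alpha$ where it is arbitrary) both integrands below are integrable and $$\mathcal{P}=\int_0^{2\pi}\sinh r\,d\varphi=\int_0^{2\pi}\sinh\rho\,\cos\alpha\,d\varphi .$$ -/

import Mathlib

noncomputable section

/-!  The hyperbolic plane of curvature `-1` is Mathlib's upper half-plane with its metric.  Its Riemannian
metric is conformal to the Euclidean one, so a direction at a point is given by the Euclidean polar angle `θ`
of a tangent vector, and hyperbolic angles are differences of such polar angles. -/

namespace HypPlane

open scoped UpperHalfPlane

theorem polar_denom_pos (θ t : ℝ) : 0 < Real.cosh t - Real.sinh t * Real.sin θ := by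
  have h1 : |Real.sinh t * Real.sin θ| ≤ |Real.sinh t| := by
    rw [abs_mul]
    exact mul_le_of_le_one_right (abs_nonneg _) (Real.abs_sin_le_one θ)
  have h2 : |Real.sinh t| < Real.cosh t :=
    abs_lt_of_sq_lt_sq (by rw [Real.cosh_sq]; linarith) (Real.cosh_pos t).le
  linarith [le_abs_self (Real.sinh t * Real.sin θ)]

/-- The point reached at (signed) time `t` on the unit-speed geodesic that starts at `z` with the initial
velocity of polar angle `θ`.  See `isometry_geodesic` and `hasDerivAt_geodesic`, which characterize it. -/
def geodesic (z : ℍ) (θ t : ℝ) : ℍ :=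
  ⟨⟨z.re + z.im * (Real.sinh t * Real.cos θ / (Real.cosh t - Real.sinh t * Real.sin θ)),
    z.im / (Real.cosh t - Real.sinh t * Real.sin θ)⟩,
    div_pos z.im_pos (polar_denom_pos θ t)⟩

theorem geodesic_zero (z : ℍ) (θ : ℝ) : geodesic z θ 0 = z := by
  apply UpperHalfPlane.ext
  apply Complex.ext <;> simp [geodesic]

theorem isometry_geodesic (z : ℍ) (θ : ℝ) : Isometry (geodesic z θ) := by
  refine Isometry.of_dist_eq fun s t => ?_
  have hc : Real.cosh (dist (geodesic z θ s) (geodesic z θ t)) = Real.cosh (s - t) := by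
    rw [UpperHalfPlane.cosh_dist, Complex.dist_eq_re_im, Real.sq_sqrt (by positivity), Real.cosh_sub]
    have hs := polar_denom_pos θ s
    have ht := polar_denom_pos θ t
    have hz := z.im_pos
    have e1 := Real.cosh_sq s
    have e2 := Real.cosh_sq t
    have e3 := Real.sin_sq_add_cos_sq θ
    simp only [geodesic, UpperHalfPlane.im]
    change 0 < z.coe.im at hz
    generalize z.coe.im = y at *
    generalize z.re = x at *
    generalize Real.sinh s = a at *
    generalize Real.sinh t = b at *
    generalize Real.cosh s = c at *
    generalize Real.cosh t = d at *
    generalize Real.sin θ = u at *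
    generalize Real.cos θ = v at *
    have key : v ^ 2 * (a * d - b * c) ^ 2 + ((d - b * u) - (c - a * u)) ^ 2 =
        2 * (c - a * u) * (d - b * u) * (c * d - a * b - 1) := by
      linear_combination (a * d - b * c) ^ 2 * e3 - (d - b * u) ^ 2 * e1 - (c - a * u) ^ 2 * e2
    have h1 : x + y * (a * v / (c - a * u)) - (x + y * (b * v / (d - b * u))) =
        y * v * (a * d - b * c) / ((c - a * u) * (d - b * u)) := by
      rw [eq_div_iff (mul_pos hs ht).ne']
      linear_combination y * v * a * (d - b * u) * div_self hs.ne' - y * v * b * (c - a * u) * div_self ht.ne'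
    have h2 : y / (c - a * u) - y / (d - b * u) =
        y * ((d - b * u) - (c - a * u)) / ((c - a * u) * (d - b * u)) := by
      rw [div_sub_div _ _ hs.ne' ht.ne']
      ring
    rw [h1, h2]
    generalize c - a * u = D at *
    generalize d - b * u = E at *
    field_simp
    linear_combination key
  rw [Real.dist_eq]
  rw [← Real.cosh_abs, ← Real.cosh_abs (s - t), abs_of_nonneg dist_nonneg] at hc
  exact Real.cosh_strictMonoOn.injOn (Set.mem_Ici.mpr dist_nonneg) (Set.mem_Ici.mpr (abs_nonneg _)) hc

/-- In the upper half-plane a tangent vector at `z` has hyperbolic norm one iff its Euclidean norm is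
`z.im`. -/
theorem hasDerivAt_geodesic (z : ℍ) (θ : ℝ) :
    HasDerivAt (fun t => (geodesic z θ t : ℂ)) (z.im * Complex.exp (θ * Complex.I)) 0 := by
  have hD : HasDerivAt (fun t => Real.cosh t - Real.sinh t * Real.sin θ)
      (Real.sinh 0 - Real.cosh 0 * Real.sin θ) 0 :=
    (Real.hasDerivAt_cosh 0).sub ((Real.hasDerivAt_sinh 0).mul_const _)
  have h0 := (polar_denom_pos θ 0).ne'
  have hre := ((((Real.hasDerivAt_sinh 0).mul_const (Real.cos θ)).div hD h0).const_mul z.im).const_add z.re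
  have him := (hasDerivAt_const (0 : ℝ) z.im).div hD h0
  have h := hre.ofReal_comp.add (him.ofReal_comp.mul_const Complex.I)
  refine (h.congr_deriv ?_).congr_of_eventuallyEq (Filter.Eventually.of_forall fun t => ?_)
  · simp [Complex.exp_mul_I]
    ring
  · exact Complex.mk_eq_add_mul_I _ _

/-- The closed half-plane on the left of the oriented line `geodesic P β`: the union of the rays from `P`
whose counterclockwise angle from the forward direction of the line lies in `[0, π]`. -/
def leftHalfPlane (P : ℍ) (β : ℝ) : Set ℍ :=
  {X | ∃ δ ∈ Set.Icc 0 Real.pi, ∃ s : ℝ, 0 ≤ s ∧ X = geodesic P (β + δ) s}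

open Classical in
/-- The signed distance from `O` to the oriented line `geodesic P β`, nonnegative on its left side. -/
def signedDist (O P : ℍ) (β : ℝ) : ℝ :=
  if O ∈ leftHalfPlane P β then Metric.infDist O (Set.range (geodesic P β))
  else -Metric.infDist O (Set.range (geodesic P β))

/-- Geodesic convexity: with two points the set contains the geodesic segment between them. -/
def GeodesicallyConvex (K : Set ℍ) : Prop :=
  ∀ P ∈ K, ∀ Q ∈ K, ∀ X : ℍ, dist P X + dist X Q = dist P Q → X ∈ K

/-- `p`, `q`, `r` are the vertices of a nondegenerate triangle, in counterclockwise order. -/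
def Counterclockwise (p q r : ℍ) : Prop :=
  ∃ β : ℝ, ∃ δ ∈ Set.Ioo 0 Real.pi, ∃ s t : ℝ, 0 < s ∧ 0 < t ∧
    q = geodesic p β s ∧ r = geodesic p (β + δ) t

/-- The points `p 0, …, p n` lie on the boundary of `K` and are in strict counterclockwise cyclic order.
(For at most two points the order condition is void.) -/
def IsInscribed (K : Set ℍ) {n : ℕ} (p : Fin (n + 1) → ℍ) : Prop :=
  (∀ i, p i ∈ frontier K) ∧ ∀ i j k, i < j → j < k → Counterclockwise (p i) (p j) (p k)

/-- The perimeter of a convex body: the length of its closed boundary curve, that is, the supremum of the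
lengths of the closed polygons inscribed in it with vertices in cyclic order (addition in `Fin (n + 1)` is
cyclic).  The perimeter of a segment is that of a two-gon, twice its length. -/
def perimeter (K : Set ℍ) : ENNReal :=
  ⨆ (n : ℕ) (p : Fin (n + 1) → ℍ) (_ : IsInscribed K p), ∑ i, edist (p i) (p (i + 1))

/-- The oriented line `geodesic P β` comes from the ideal point at angle `θ` as seen from `O`: run
backwards, it is asymptotic to the ray from `O` with direction `θ`. -/
def ComesFromIdealPoint (O : ℍ) (θ : ℝ) (P : ℍ) (β : ℝ) : Prop :=
  ∃ C : ℝ, ∀ t : ℝ, 0 ≤ t → dist (geodesic P β (-t)) (geodesic O θ t) ≤ C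

/-- The line `geodesic P β`, oriented away from the ideal point `R` at angle `θ` as seen from `O`, is the
right-hand support line of `K` through `R` as viewed from `R`, and `P` is a point of contact with `K`. -/
def IsRightSupport (K : Set ℍ) (O : ℍ) (θ : ℝ) (P : ℍ) (β : ℝ) : Prop :=
  P ∈ K ∧ ComesFromIdealPoint O θ P β ∧ K ⊆ leftHalfPlane P β

/-- `α` is the angle at `P` from the radial direction (pointing away from `O`) to the normal of the oriented
line `geodesic P β` that points to its right; this normal has the polar angle `β - π / 2`, so the radial
direction has the polar angle `β - π / 2 - α`.  If `P = O`, then every `α` qualifies. -/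
def IsNormalAngle (O P : ℍ) (β α : ℝ) : Prop :=
  geodesic P (β - Real.pi / 2 - α) (-dist O P) = O

end HypPlane

end

/-! In the hyperboloid model an ideal point at angle `θ` is a null vector, and its pairing `horo O X
θ` with a point `X` is the exponential of a Busemann function. Let `horoSlope` be minus its
logarithmic derivative in `θ`. If the ideal point is put at infinity in a half-plane with `O` at
height one above the origin, `horo` is the reciprocal of the height of `X` and `horoSlope` its
horizontal coordinate, increasing to the right as seen from infinity. Hence the right-hand support
line passes through the points of `K` of maximal slope (`isRightSupport_iff`), and this maximum
`supportFn` is the hyperbolic sine of the signed distance of `O` from the line (`sinh_signedDist`,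
`IsRightSupport.lineFn_eq`). A right triangle identifies it with the second integrand
(`lineFn_of_isNormalAngle`).

It remains to integrate `supportFn`. A slope is an exact derivative. For two points the larger slope
changes hands at the two ends of the line through them, and there the Busemann functions differ by
exactly the distance (`Switch`). So the maximal slope of two or three points integrates to the
perimeter of the two-gon or triangle. Gluing triangles along chords extends this to convex polygons
(`integral_partialSups`).

For general `K`, monotonicity of the integral bounds every inscribed polygon (`perimeter_le`).
Conversely, finitely many contact points approximate `supportFn` uniformly, and those that matter
can be ordered into an inscribed polygon (`ConvexPosition.exists_polygon`), which gives
`toReal_perimeter`. -/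

noncomputable section

namespace HypPlane

open scoped UpperHalfPlane

/-! ### The hyperboloid model and polar coordinates. -/

/-- Vectors of Minkowski space in light-cone coordinates. -/
@[ext] structure LVec where
  a : ℝ
  b : ℝ
  c : ℝ

/-- The Minkowski form, with the sign that makes it positive on pairs of points of the hyperboloid. -/
def LVec.form (u v : LVec) : ℝ := (u.a * v.c + u.c * v.a) / 2 - u.b * v.b

/-- The oriented volume. -/
def LVec.vol (u v w : LVec) : ℝ :=
  (u.a * (v.b * w.c - v.c * w.b) - u.b * (v.a * w.c - v.c * w.a) + u.c * (v.a * w.b - v.b * w.a)) / 2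

/-- The point of the hyperboloid that represents `X`, where `O` is represented by the origin. -/
def vec (O X : ℍ) : LVec :=
  ⟨O.im / X.im, (X.re - O.re) / X.im, ((X.re - O.re) ^ 2 + X.im ^ 2) / (X.im * O.im)⟩

/-- The change of the origin from `O` to `P`. -/
def reframe (O P : ℍ) (u : LVec) : LVec :=
  ⟨P.im / O.im * u.a, u.b + (O.re - P.re) / O.im * u.a,
    (O.im * u.c + 2 * (O.re - P.re) * u.b + (O.re - P.re) ^ 2 / O.im * u.a) / P.im⟩

/-- The point with the polar coordinates `(ψ, s)`. -/
def polar (ψ s : ℝ) : LVec :=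
  ⟨Real.cosh s - Real.sinh s * Real.sin ψ, Real.sinh s * Real.cos ψ,
    Real.cosh s + Real.sinh s * Real.sin ψ⟩

/-- The null vector that represents the ideal point at the angle `θ`. -/
def null (θ : ℝ) : LVec := ⟨1 - Real.sin θ, Real.cos θ, 1 + Real.sin θ⟩

/-- The derivative of `null`. -/
def dnull (θ : ℝ) : LVec := ⟨-Real.cos θ, -Real.sin θ, Real.cos θ⟩

theorem form_reframe (O P : ℍ) (u v : LVec) :
    (reframe O P u).form (reframe O P v) = u.form v := by
  have h1 := O.im_pos.ne'
  have h2 := P.im_pos.ne'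
  simp only [LVec.form, reframe]
  field_simp
  ring

theorem vol_reframe (O P : ℍ) (u v w : LVec) :
    (reframe O P u).vol (reframe O P v) (reframe O P w) = u.vol v w := by
  have h1 := O.im_pos.ne'
  have h2 := P.im_pos.ne'
  simp only [LVec.vol, reframe]
  field_simp
  ring

theorem reframe_vec (O P X : ℍ) : reframe O P (vec O X) = vec P X := by
  have h1 := O.im_pos.ne'
  have h2 := P.im_pos.ne'
  have h3 := X.im_pos.ne'
  simp only [vec, reframe]
  ext
  · field_simp
  · simp only
    field_simp
    ring
  · simp only
    field_simp
    ring

theorem form_vec (O X Y : ℍ) : (vec O X).form (vec O Y) = Real.cosh (dist X Y) := by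
  have h1 := O.im_pos.ne'
  have h2 := X.im_pos.ne'
  have h3 := Y.im_pos.ne'
  rw [UpperHalfPlane.cosh_dist, Complex.dist_eq_re_im, Real.sq_sqrt (by positivity)]
  simp only [UpperHalfPlane.coe_re, UpperHalfPlane.coe_im, LVec.form, vec]
  field_simp
  ring

theorem form_vec_self (O X : ℍ) : (vec O X).form (vec O X) = 1 := by
  simp [form_vec]

theorem vec_self (O : ℍ) : vec O O = ⟨1, 0, 1⟩ := by
  have h1 := O.im_pos.ne'
  simp only [vec]
  ext
  · simp [h1]
  · simp
  · simp only
    field_simp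
    ring

theorem vec_a_pos (O X : ℍ) : 0 < (vec O X).a := div_pos O.im_pos X.im_pos

theorem vec_geodesic (P : ℍ) (ψ s : ℝ) : vec P (geodesic P ψ s) = polar ψ s := by
  have h1 := P.im_pos.ne'
  have h2 := (polar_denom_pos ψ s).ne'
  have e1 := Real.cosh_sq s
  have e3 := Real.sin_sq_add_cos_sq ψ
  have hre : (geodesic P ψ s).re = P.re +
    P.im * (Real.sinh s * Real.cos ψ / (Real.cosh s - Real.sinh s * Real.sin ψ)) := rfl
  have him : (geodesic P ψ s).im = P.im / (Real.cosh s - Real.sinh s * Real.sin ψ) := rfl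
  simp only [vec, polar, hre, him]
  ext
  · simp only
    field_simp
  · simp only
    field_simp
    ring
  · simp only
    field_simp
    linear_combination P.im ^ 2 * ((Real.sinh s) ^ 2 * e3 - e1)

theorem vec_injective (P : ℍ) : Function.Injective (vec P) := by
  intro X Y h
  have h1 := P.im_pos.ne'
  have h2 := X.im_pos.ne'
  have h3 := Y.im_pos.ne'
  have ha := congrArg LVec.a h
  have hb := congrArg LVec.b h
  simp only [vec] at ha hb
  have him : X.im = Y.im := by
    field_simp at ha
    exact ha.symm
  rw [him] at hb
  have hre : X.re = Y.re := by
    field_simp at hb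
    linarith
  exact UpperHalfPlane.ext (Complex.ext hre him)

theorem exists_cos_sin {x y : ℝ} (h : x ^ 2 + y ^ 2 = 1) :
    ∃ ψ, x = Real.cos ψ ∧ y = Real.sin ψ := by
  have hn : ‖(⟨x, y⟩ : ℂ)‖ = 1 := by
    rw [Complex.norm_eq_sqrt_sq_add_sq]
    simp [h]
  have h0 : (⟨x, y⟩ : ℂ) ≠ 0 := by
    intro h0
    rw [h0] at hn
    simp at hn
  refine ⟨Complex.arg ⟨x, y⟩, ?_, ?_⟩
  · rw [Complex.cos_arg h0, hn]; simp
  · rw [Complex.sin_arg, hn]; simp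

theorem exists_polar (x y : ℝ) :
    ∃ r ψ : ℝ, 0 ≤ r ∧ x = r * Real.cos ψ ∧ y = r * Real.sin ψ := by
  refine ⟨‖(⟨x, y⟩ : ℂ)‖, Complex.arg ⟨x, y⟩, norm_nonneg _, ?_, ?_⟩
  · rw [Complex.norm_mul_cos_arg]
  · rw [Complex.norm_mul_sin_arg]

theorem exists_geodesic (P X : ℍ) : ∃ ψ s, 0 ≤ s ∧ X = geodesic P ψ s := by
  have hf := form_vec_self P X
  have ha := vec_a_pos P X
  obtain ⟨r, ψ, hr, hx, hy⟩ := exists_polar (vec P X).b (((vec P X).c - (vec P X).a) / 2)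
  have e3 := Real.sin_sq_add_cos_sq ψ
  have hc : 0 < (vec P X).c := by
    have hf' := hf
    simp only [LVec.form] at hf'
    by_contra hc
    nlinarith [sq_nonneg (vec P X).b]
  have hr2 : (((vec P X).c + (vec P X).a) / 2) ^ 2 = 1 + r ^ 2 := by
    simp only [LVec.form] at hf
    linear_combination hf + ((vec P X).b + r * Real.cos ψ) * hx +
      (((vec P X).c - (vec P X).a) / 2 + r * Real.sin ψ) * hy + r ^ 2 * e3
  refine ⟨ψ, Real.arsinh r, Real.arsinh_nonneg_iff.2 hr, vec_injective P ?_⟩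
  have hch : Real.cosh (Real.arsinh r) = ((vec P X).c + (vec P X).a) / 2 := by
    rw [Real.cosh_arsinh, ← hr2, Real.sqrt_sq (by positivity)]
  rw [vec_geodesic]
  ext
  · simp only [polar, Real.sinh_arsinh, hch]; linarith
  · simp only [polar, Real.sinh_arsinh, hx]
  · simp only [polar, Real.sinh_arsinh, hch]; linarith

theorem geodesic_add_two_pi (P : ℍ) (ψ s : ℝ) (k : ℤ) :
    geodesic P (ψ + k * (2 * Real.pi)) s = geodesic P ψ s := by
  apply vec_injective P
  simp only [vec_geodesic, polar, Real.sin_add_int_mul_two_pi, Real.cos_add_int_mul_two_pi]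

theorem geodesic_add_pi (P : ℍ) (ψ s : ℝ) :
    geodesic P (ψ + Real.pi) s = geodesic P ψ (-s) := by
  apply vec_injective P
  simp only [vec_geodesic, polar, Real.sin_add_pi, Real.cos_add_pi, Real.sinh_neg, Real.cosh_neg]
  ext <;> simp

/-! ### Half-planes, orientation and distance from a line. -/

/-- The hyperbolic sine of the signed distance of `X` from the oriented line `geodesic P β`. -/
def lineFn (P : ℍ) (β : ℝ) (X : ℍ) : ℝ :=
  ((vec P X).c - (vec P X).a) / 2 * Real.cos β - (vec P X).b * Real.sin β

theorem lineFn_geodesic (P : ℍ) (β ψ s : ℝ) :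
    lineFn P β (geodesic P ψ s) = Real.sinh s * Real.sin (ψ - β) := by
  simp only [lineFn, vec_geodesic, polar, Real.sin_sub]
  ring

theorem exists_angle_near (β ψ : ℝ) :
    ∃ δ ∈ Set.Ico 0 (2 * Real.pi), ∃ k : ℤ, ψ = β + δ + k * (2 * Real.pi) := by
  refine ⟨toIcoMod Real.two_pi_pos 0 (ψ - β), ?_, toIcoDiv Real.two_pi_pos 0 (ψ - β), ?_⟩
  · simpa using toIcoMod_mem_Ico Real.two_pi_pos 0 (ψ - β)
  · have := toIcoMod_add_toIcoDiv_zsmul Real.two_pi_pos 0 (ψ - β)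
    rw [zsmul_eq_mul] at this
    linarith

theorem sin_neg_of_mem_Ioo {δ : ℝ} (h1 : Real.pi < δ) (h2 : δ < 2 * Real.pi) : Real.sin δ < 0 := by
  have := Real.sin_pos_of_pos_of_lt_pi (x := δ - Real.pi) (by linarith) (by linarith)
  rw [Real.sin_sub_pi] at this
  linarith

/-- In polar coordinates at `P`, `lineFn` is `sinh s * sin δ` with `δ` the angle from the line, so
its sign decides the side. A half-plane thus becomes a linear inequality. -/
theorem mem_leftHalfPlane_iff (P : ℍ) (β : ℝ) (X : ℍ) :
    X ∈ leftHalfPlane P β ↔ 0 ≤ lineFn P β X := by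
  constructor
  · rintro ⟨δ, hδ, s, hs, rfl⟩
    rw [lineFn_geodesic, add_sub_cancel_left]
    exact mul_nonneg (Real.sinh_nonneg_iff.2 hs) (Real.sin_nonneg_of_mem_Icc hδ)
  · intro h
    obtain ⟨ψ, s, hs, rfl⟩ := exists_geodesic P X
    obtain ⟨δ, hδ, k, rfl⟩ := exists_angle_near β ψ
    rw [lineFn_geodesic, show β + δ + k * (2 * Real.pi) - β = δ + k * (2 * Real.pi) by ring,
      Real.sin_add_int_mul_two_pi] at h
    rcases hs.eq_or_lt with rfl | hs'
    · exact ⟨0, ⟨le_rfl, Real.pi_pos.le⟩, 0, le_rfl, by simp [geodesic_zero]⟩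
    · refine ⟨δ, ⟨hδ.1, ?_⟩, s, hs, geodesic_add_two_pi _ _ _ _⟩
      by_contra hc
      exact absurd h (not_le.2 (mul_neg_of_pos_of_neg (Real.sinh_pos_iff.2 hs')
        (sin_neg_of_mem_Ioo (not_le.1 hc) hδ.2)))

theorem vol_vec (O p q r : ℍ) : (vec O p).vol (vec O q) (vec O r) = (vec p p).vol (vec p q) (vec p r) := by
  rw [← reframe_vec O p p, ← reframe_vec O p q, ← reframe_vec O p r, vol_reframe]

/-- Moving the origin to `p` preserves the volume, and there it equals `sinh s * sinh t` times the
sine of the angle at `p`. -/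
theorem counterclockwise_iff (O p q r : ℍ) :
    Counterclockwise p q r ↔ 0 < (vec O p).vol (vec O q) (vec O r) := by
  have key : ∀ β ψ s t, (vec p p).vol (polar β s) (polar ψ t) =
      Real.sinh s * Real.sinh t * Real.sin (ψ - β) := by
    intro β ψ s t
    simp only [vec_self, LVec.vol, polar, Real.sin_sub]
    ring
  rw [vol_vec]
  constructor
  · rintro ⟨β, δ, hδ, s, t, hs, ht, rfl, rfl⟩
    rw [vec_geodesic, vec_geodesic, key, add_sub_cancel_left]
    exact mul_pos (mul_pos (Real.sinh_pos_iff.2 hs) (Real.sinh_pos_iff.2 ht))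
      (Real.sin_pos_of_mem_Ioo hδ)
  · intro h
    obtain ⟨β, s, hs, rfl⟩ := exists_geodesic p q
    obtain ⟨ψ, t, ht, rfl⟩ := exists_geodesic p r
    obtain ⟨δ, hδ, k, rfl⟩ := exists_angle_near β ψ
    rw [vec_geodesic, vec_geodesic, key,
      show β + δ + k * (2 * Real.pi) - β = δ + k * (2 * Real.pi) by ring,
      Real.sin_add_int_mul_two_pi] at h
    have hs' : 0 < s := by
      rcases hs.eq_or_lt with rfl | hs'
      · simp at h
      · exact hs'
    have ht' : 0 < t := by
      rcases ht.eq_or_lt with rfl | ht'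
      · simp at h
      · exact ht'
    have hsin : 0 < Real.sin δ :=
      pos_of_mul_pos_right h (mul_nonneg (Real.sinh_nonneg_iff.2 hs) (Real.sinh_nonneg_iff.2 ht))
    refine ⟨β, δ, ⟨?_, ?_⟩, s, t, hs', ht', rfl, geodesic_add_two_pi _ _ _ _⟩
    · rcases hδ.1.eq_or_lt with rfl | h0
      · simp at hsin
      · exact h0
    · by_contra hc
      rcases (not_lt.1 hc).eq_or_lt with h0 | h0
      · rw [← h0] at hsin
        simp at hsin
      · exact absurd hsin (sin_neg_of_mem_Ioo h0 hδ.2).not_gt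

theorem sinh_infDist (O P : ℍ) (β : ℝ) :
    Real.sinh (Metric.infDist O (Set.range (geodesic P β))) = |lineFn P β O| := by
  obtain ⟨ψ, s, hs, rfl⟩ := exists_geodesic P O
  set X := geodesic P ψ s with hX
  set a := Real.cosh s with ha
  set b := Real.sinh s * Real.cos (ψ - β) with hb
  have hdist : ∀ t, Real.cosh (dist X (geodesic P β t)) = a * Real.cosh t - b * Real.sinh t := by
    intro t
    rw [← form_vec P, hX, vec_geodesic, vec_geodesic]
    simp only [LVec.form, polar, ha, hb, Real.cos_sub]
    ring
  have hl : lineFn P β X = Real.sinh s * Real.sin (ψ - β) := lineFn_geodesic P β ψ s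
  have hab : a ^ 2 - b ^ 2 = 1 + lineFn P β X ^ 2 := by
    rw [hl]
    linear_combination Real.cosh_sq s - Real.sinh s ^ 2 * Real.sin_sq_add_cos_sq (ψ - β)
  set l := lineFn P β X
  set m := Real.sqrt (1 + l ^ 2) with hm
  have hm0 : 0 < m := Real.sqrt_pos.2 (by positivity)
  have hm2 : m ^ 2 = 1 + l ^ 2 := Real.sq_sqrt (by positivity)
  have ha0 : 0 < a := Real.cosh_pos s
  have hcosh : Real.cosh (Real.arsinh |l|) = m := by rw [Real.cosh_arsinh, sq_abs]
  have h0 : 0 ≤ Real.arsinh |l| := Real.arsinh_nonneg_iff.2 (abs_nonneg l)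
  suffices h : Metric.infDist X (Set.range (geodesic P β)) = Real.arsinh |l| by
    rw [h, Real.sinh_arsinh]
  apply le_antisymm
  -- The function `a cosh t - b sinh t` has minimum `√(a² - b²) = m`, attained where `sinh t = b /
  -- m`.
  · have h1 := Metric.infDist_le_dist_of_mem (x := X)
      (Set.mem_range_self (f := geodesic P β) (Real.arsinh (b / m)))
    refine h1.trans ?_
    rw [← abs_of_nonneg h0, ← abs_of_nonneg (dist_nonneg (x := X)), ← Real.cosh_le_cosh, hdist, hcosh,
      Real.sinh_arsinh, Real.cosh_arsinh,
      show 1 + (b / m) ^ 2 = (a / m) ^ 2 by field_simp; linarith,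
      Real.sqrt_sq (by positivity)]
    apply le_of_eq
    field_simp
    linarith
  · apply (Metric.le_infDist (Set.range_nonempty _)).2
    rintro _ ⟨t, rfl⟩
    rw [← abs_of_nonneg h0, ← abs_of_nonneg (dist_nonneg (x := X)), ← Real.cosh_le_cosh, hdist, hcosh]
    have hpos : 0 < a * Real.cosh t - b * Real.sinh t := by
      rw [← hdist]
      exact Real.cosh_pos _
    apply le_of_sq_le_sq _ hpos.le
    have := Real.cosh_sq t
    nlinarith [sq_nonneg (a * Real.sinh t - b * Real.cosh t)]

theorem sinh_signedDist (O P : ℍ) (β : ℝ) : Real.sinh (signedDist O P β) = lineFn P β O := by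
  unfold signedDist
  split_ifs with h
  · rw [sinh_infDist, abs_of_nonneg ((mem_leftHalfPlane_iff P β O).1 h)]
  · rw [mem_leftHalfPlane_iff, not_le] at h
    rw [Real.sinh_neg, sinh_infDist, abs_of_neg h, neg_neg]

/-- The right-triangle relation that makes the two integrands equal pointwise. -/
theorem lineFn_of_isNormalAngle {O P : ℍ} {β α : ℝ} (h : IsNormalAngle O P β α) :
    lineFn P β O = Real.sinh (dist O P) * Real.cos α := by
  unfold IsNormalAngle at h
  conv_lhs => rw [← h]
  rw [lineFn_geodesic, show β - Real.pi / 2 - α - β = -(α + Real.pi / 2) by ring, Real.sin_neg,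
    Real.sin_add_pi_div_two, Real.sinh_neg]
  ring

theorem dist_geodesic_self (P : ℍ) (ψ s : ℝ) : dist P (geodesic P ψ s) = |s| := by
  have h := (isometry_geodesic P ψ).dist_eq 0 s
  rw [geodesic_zero] at h
  rw [h, Real.dist_eq, zero_sub, abs_neg]

theorem exists_isNormalAngle (O P : ℍ) (β : ℝ) : ∃ α, IsNormalAngle O P β α := by
  obtain ⟨ψ, s, hs, hO⟩ := exists_geodesic P O
  refine ⟨β - Real.pi / 2 - (ψ - Real.pi), ?_⟩
  have hd : dist O P = s := by
    rw [dist_comm, hO, dist_geodesic_self, abs_of_nonneg hs]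
  unfold IsNormalAngle
  rw [hd, ← geodesic_add_pi, show β - Real.pi / 2 - (β - Real.pi / 2 - (ψ - Real.pi)) + Real.pi = ψ by ring]
  exact hO.symm

/-! ### Busemann functions and their slopes. -/

/-- The exponential of the Busemann function of the ideal point at the angle `θ`. -/
def horo (O X : ℍ) (θ : ℝ) : ℝ := (vec O X).form (null θ)

/-- Minus the logarithmic derivative of `horo`: the position, as seen from the ideal point at the angle
`θ`, of the line from there through `X`. -/
def horoSlope (O X : ℍ) (θ : ℝ) : ℝ := -(vec O X).form (dnull θ) / horo O X θ

theorem vec_c_pos (O X : ℍ) : 0 < (vec O X).c :=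
  div_pos (add_pos_of_nonneg_of_pos (sq_nonneg _) (pow_pos X.im_pos 2)) (mul_pos X.im_pos O.im_pos)

theorem vec_norm (O X : ℍ) : (vec O X).a * (vec O X).c = 1 + (vec O X).b ^ 2 := by
  have := form_vec_self O X
  simp only [LVec.form] at this
  linarith

/-- A future timelike vector pairs positively with a future null vector. If it did not, the identity
`hid` would force `cos θ = 0`, where the pairing is visibly positive. -/
theorem horo_pos (O X : ℍ) (θ : ℝ) : 0 < horo O X θ := by
  have ha := vec_a_pos O X
  have hc := vec_c_pos O X
  have h := vec_norm O X
  have e := Real.sin_sq_add_cos_sq θ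
  unfold horo LVec.form null
  simp only
  by_contra hn
  have h1 := Real.neg_one_le_sin θ
  have h2 := Real.sin_le_one θ
  have hp : 0 ≤ (vec O X).a * (1 + Real.sin θ) + (vec O X).c * (1 - Real.sin θ) :=
    add_nonneg (mul_nonneg ha.le (by linarith)) (mul_nonneg hc.le (by linarith))
  have hsq : ((vec O X).a * (1 + Real.sin θ) + (vec O X).c * (1 - Real.sin θ)) ^ 2 ≤
      (2 * ((vec O X).b * Real.cos θ)) ^ 2 := by
    apply pow_le_pow_left₀ hp
    linarith
  have hid : ((vec O X).a * (1 + Real.sin θ) + (vec O X).c * (1 - Real.sin θ)) ^ 2 -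
      (2 * ((vec O X).b * Real.cos θ)) ^ 2 =
      ((vec O X).a * (1 + Real.sin θ) - (vec O X).c * (1 - Real.sin θ)) ^ 2 + 4 * Real.cos θ ^ 2 := by
    linear_combination 4 * Real.cos θ ^ 2 * h - 4 * (vec O X).a * (vec O X).c * e
  have hcos : Real.cos θ = 0 := by
    have := sq_nonneg ((vec O X).a * (1 + Real.sin θ) - (vec O X).c * (1 - Real.sin θ))
    exact pow_eq_zero_iff two_ne_zero |>.1 (by nlinarith [sq_nonneg (Real.cos θ)])
  rw [hcos] at hn e
  have : Real.sin θ = 1 ∨ Real.sin θ = -1 := sq_eq_sq_iff_eq_or_eq_neg.1 (by linarith)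
  rcases this with h3 | h3 <;> rw [h3] at hn <;> linarith

theorem form_dnull (O X : ℍ) (θ : ℝ) :
    (vec O X).form (dnull θ) = -(horo O X θ * horoSlope O X θ) := by
  have := (horo_pos O X θ).ne'
  unfold horoSlope
  field_simp

theorem hasDerivAt_horo (O X : ℍ) (θ : ℝ) :
    HasDerivAt (horo O X) ((vec O X).form (dnull θ)) θ := by
  have hs := Real.hasDerivAt_sin θ
  have hc := Real.hasDerivAt_cos θ
  have h := ((((hs.const_add 1).const_mul (vec O X).a).add ((hs.const_sub 1).const_mul (vec O X).c)).div_const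
    2).sub (hc.const_mul (vec O X).b)
  refine (h.congr_deriv ?_)
  simp only [LVec.form, dnull]

theorem hasDerivAt_log_horo (O X : ℍ) (θ : ℝ) :
    HasDerivAt (fun t => -Real.log (horo O X t)) (horoSlope O X θ) θ := by
  refine (((hasDerivAt_horo O X θ).log (horo_pos O X θ).ne').neg).congr_deriv ?_
  rw [horoSlope, neg_div]

theorem continuous_horo (O : ℍ) : Continuous fun p : ℍ × ℝ => horo O p.1 p.2 := by
  have h : ∀ p : ℍ × ℝ, p.1.im ≠ 0 := fun p => p.1.im_pos.ne'
  have h' : ∀ p : ℍ × ℝ, p.1.im * O.im ≠ 0 := fun p => mul_ne_zero (h p) O.im_pos.ne'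
  have h1 := UpperHalfPlane.continuous_im
  have h2 := UpperHalfPlane.continuous_re
  unfold horo LVec.form null vec
  fun_prop (disch := assumption)

theorem continuous_horoSlope (O : ℍ) : Continuous fun p : ℍ × ℝ => horoSlope O p.1 p.2 := by
  have h : ∀ p : ℍ × ℝ, p.1.im ≠ 0 := fun p => p.1.im_pos.ne'
  have h' : ∀ p : ℍ × ℝ, p.1.im * O.im ≠ 0 := fun p => mul_ne_zero (h p) O.im_pos.ne'
  have h1 := UpperHalfPlane.continuous_im
  have h2 := UpperHalfPlane.continuous_re
  have h3 : Continuous fun p : ℍ × ℝ => (vec O p.1).form (dnull p.2) := by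
    unfold LVec.form dnull vec
    fun_prop (disch := assumption)
  exact h3.neg.div (continuous_horo O) fun p => (horo_pos O p.1 p.2).ne'

theorem continuous_horoSlope_right (O X : ℍ) : Continuous (horoSlope O X) :=
  (continuous_horoSlope O).comp (Continuous.prodMk_right X)

theorem horo_periodic (O X : ℍ) : Function.Periodic (horo O X) (2 * Real.pi) := by
  intro θ
  simp only [horo, null, Real.sin_add_two_pi, Real.cos_add_two_pi]

theorem horoSlope_periodic (O X : ℍ) : Function.Periodic (horoSlope O X) (2 * Real.pi) := by
  intro θ
  rw [horoSlope, horo_periodic, horoSlope]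
  simp only [dnull, Real.sin_add_two_pi, Real.cos_add_two_pi]

theorem horo_self (O : ℍ) (θ : ℝ) : horo O O θ = 1 := by
  rw [horo, vec_self]
  simp only [LVec.form, null]
  ring

theorem horoSlope_self (O : ℍ) (θ : ℝ) : horoSlope O O θ = 0 := by
  rw [horoSlope, vec_self]
  simp only [LVec.form, dnull]
  ring

/-- The volume is the Wronskian in `θ` of the two pairings with `null θ`, hence a multiple of the
difference of their logarithmic derivatives. It links slopes to orientation. -/
theorem vol_null (O X Y : ℍ) (θ : ℝ) : (vec O X).vol (vec O Y) (null θ) =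
    horo O X θ * horo O Y θ * (horoSlope O X θ - horoSlope O Y θ) := by
  have h : horo O X θ * horo O Y θ * (horoSlope O X θ - horoSlope O Y θ) =
      (vec O Y).form (dnull θ) * horo O X θ - (vec O X).form (dnull θ) * horo O Y θ := by
    rw [form_dnull, form_dnull]
    ring
  rw [h]
  simp only [horo, LVec.vol, LVec.form, null, dnull]
  have e := Real.sin_sq_add_cos_sq θ
  linear_combination -((vec O X).a * (vec O Y).b - (vec O X).b * (vec O Y).a -
    (vec O X).c * (vec O Y).b + (vec O X).b * (vec O Y).c) / 2 * e

/-! ### Lines from an ideal point and support lines. -/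

theorem reframe_null_spec (O P : ℍ) (θ : ℝ) :
    ((reframe O P (null θ)).a + (reframe O P (null θ)).c) / 2 = horo O P θ ∧
    (reframe O P (null θ)).a * (reframe O P (null θ)).c = (reframe O P (null θ)).b ^ 2 := by
  constructor
  · rw [horo, ← form_reframe O P, reframe_vec, vec_self]
    simp only [LVec.form]
    ring
  · have h : (reframe O P (null θ)).form (reframe O P (null θ)) = 0 := by
      rw [form_reframe]
      simp only [LVec.form, null]
      linear_combination - Real.sin_sq_add_cos_sq θ
    simp only [LVec.form] at h
    linarith

/-- Each geodesic is half the sum of `e^t` and `e^(-t)` times the null vectors of its ends, so only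
the first coefficient can make the distance unbounded. -/
theorem cosh_dist_asymptotic (O P : ℍ) (θ β t : ℝ) :
    Real.cosh (dist (geodesic P β (-t)) (geodesic O θ t)) =
      Real.exp t ^ 2 / 4 * (null (β + Real.pi)).form (reframe O P (null θ)) +
      ((null β).form (reframe O P (null θ)) +
        (null (β + Real.pi)).form (reframe O P (null (θ + Real.pi)))) / 4 +
      Real.exp (-t) ^ 2 / 4 * (null β).form (reframe O P (null (θ + Real.pi))) := by
  rw [← form_vec P, vec_geodesic, ← reframe_vec O P, vec_geodesic]
  have he : Real.exp t * Real.exp (-t) = 1 := by rw [← Real.exp_add]; simp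
  simp only [LVec.form, polar, reframe, null, Real.sin_add_pi, Real.cos_add_pi, Real.sinh_neg, Real.cosh_neg]
  rw [Real.cosh_eq, Real.sinh_eq]
  have h1 := O.im_pos.ne'
  have h2 := P.im_pos.ne'
  have he' : Real.exp (-t) = (Real.exp t)⁻¹ := Real.exp_neg t
  have h3 := (Real.exp_pos t).ne'
  rw [he']
  field_simp
  ring

/-- The distance stays bounded exactly when the coefficient of `e^(2t)` vanishes, that is, when the
two null vectors are proportional. -/
theorem comesFromIdealPoint_iff (O P : ℍ) (θ β : ℝ) : ComesFromIdealPoint O θ P β ↔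
    (null (β + Real.pi)).form (reframe O P (null θ)) = 0 := by
  unfold ComesFromIdealPoint
  have key := cosh_dist_asymptotic O P θ β
  set k := (null (β + Real.pi)).form (reframe O P (null θ)) with hk
  set k0 := ((null β).form (reframe O P (null θ)) +
        (null (β + Real.pi)).form (reframe O P (null (θ + Real.pi)))) / 4
  set k1 := (null β).form (reframe O P (null (θ + Real.pi)))
  have hk1 : ∀ t : ℝ, 0 ≤ t → |Real.exp (-t) ^ 2 / 4 * k1| ≤ |k1| := by
    intro t ht
    have h1 : Real.exp (-t) ≤ 1 := Real.exp_le_one_iff.2 (by linarith)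
    have h2 : Real.exp (-t) ^ 2 ≤ 1 := pow_le_one₀ (Real.exp_pos _).le h1
    rw [abs_mul, abs_of_nonneg (by positivity)]
    nlinarith [abs_nonneg k1]
  constructor
  · rintro ⟨C, hC⟩
    obtain ⟨hq, hN⟩ := reframe_null_spec O P θ
    have hk' : k = horo O P θ + (reframe O P (null θ)).b * Real.cos β +
        ((reframe O P (null θ)).c - (reframe O P (null θ)).a) / 2 * Real.sin β := by
      rw [hk, ← hq]
      simp only [LVec.form, null, Real.sin_add_pi, Real.cos_add_pi]
      ring
    -- Cauchy–Schwarz in the plane: the vector paired with `(cos β, sin β)` has length `horo O P θ`.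
    have hk0 : 0 ≤ k := by
      have hle := abs_le_of_sq_le_sq
        (a := (reframe O P (null θ)).b * Real.cos β +
          ((reframe O P (null θ)).c - (reframe O P (null θ)).a) / 2 * Real.sin β)
        (b := horo O P θ) (by
          have hid : horo O P θ ^ 2 - ((reframe O P (null θ)).b * Real.cos β +
              ((reframe O P (null θ)).c - (reframe O P (null θ)).a) / 2 * Real.sin β) ^ 2 =
              ((reframe O P (null θ)).b * Real.sin β -
              ((reframe O P (null θ)).c - (reframe O P (null θ)).a) / 2 * Real.cos β) ^ 2 := by
            rw [← hq]
            linear_combination hN - ((reframe O P (null θ)).b ^ 2 +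
              (((reframe O P (null θ)).c - (reframe O P (null θ)).a) / 2) ^ 2) *
              Real.sin_sq_add_cos_sq β
          nlinarith [sq_nonneg ((reframe O P (null θ)).b * Real.sin β -
              ((reframe O P (null θ)).c - (reframe O P (null θ)).a) / 2 * Real.cos β)])
        (horo_pos O P θ).le
      rw [hk']
      linarith [(abs_le.1 hle).1]
    by_contra hne
    have hpos : 0 < k := lt_of_le_of_ne hk0 (Ne.symm hne)
    have hbound : ∀ t : ℝ, 0 ≤ t → k * t ≤ 4 * (Real.cosh C + |k0| + |k1|) := by
      intro t ht
      have h1 : Real.cosh (dist (geodesic P β (-t)) (geodesic O θ t)) ≤ Real.cosh C := by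
        rw [Real.cosh_le_cosh, abs_of_nonneg dist_nonneg]
        exact (hC t ht).trans (le_abs_self C)
      rw [key] at h1
      have h2 := neg_abs_le k0
      have h3 := (abs_le.1 (hk1 t ht)).1
      have h4 : t ≤ Real.exp t ^ 2 := by
        have := Real.add_one_le_exp t
        nlinarith
      nlinarith [mul_le_mul_of_nonneg_left h4 hk0]
    have hM : 0 < Real.cosh C + |k0| + |k1| := by
      have := Real.cosh_pos C
      positivity
    -- With `M` the sum on the right of `hbound`, this time turns the bound into `8 M ≤ 4 M`.
    have := hbound (8 * (Real.cosh C + |k0| + |k1|) / k) (by positivity)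
    rw [mul_div_cancel₀ _ hpos.ne'] at this
    linarith
  · intro h0
    refine ⟨|k0| + |k1|, fun t ht => ?_⟩
    have h1 := key t
    rw [h0, mul_zero, zero_add] at h1
    have h2 : dist (geodesic P β (-t)) (geodesic O θ t) ≤
        Real.sinh (dist (geodesic P β (-t)) (geodesic O θ t)) :=
      Real.self_le_sinh_iff.2 dist_nonneg
    have h3 := Real.sinh_lt_cosh (dist (geodesic P β (-t)) (geodesic O θ t))
    have h4 := le_abs_self k0
    have h5 := (abs_le.1 (hk1 t ht)).2
    linarith

theorem exists_comesFromIdealPoint (O P : ℍ) (θ : ℝ) : ∃ β, ComesFromIdealPoint O θ P β := by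
  obtain ⟨hq, hN⟩ := reframe_null_spec O P θ
  have hp := horo_pos O P θ
  obtain ⟨β, h1, h2⟩ := exists_cos_sin (x := -(reframe O P (null θ)).b / horo O P θ)
    (y := -(((reframe O P (null θ)).c - (reframe O P (null θ)).a) / 2) / horo O P θ) (by
      rw [div_pow, div_pow, ← add_div, div_eq_one_iff_eq (by positivity), ← hq]
      linear_combination -hN)
  refine ⟨β, (comesFromIdealPoint_iff O P θ β).2 ?_⟩
  rw [div_eq_iff hp.ne'] at h1 h2
  have e := Real.sin_sq_add_cos_sq β
  simp only [null] at h1 h2 hq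
  simp only [LVec.form, null, Real.sin_add_pi, Real.cos_add_pi]
  linear_combination hq - Real.cos β * h1 - Real.sin β * h2 - horo O P θ * e

theorem lineFn_eq {O P : ℍ} {θ β : ℝ} (h : ComesFromIdealPoint O θ P β) (X : ℍ) :
    lineFn P β X = horo O X θ * (horoSlope O P θ - horoSlope O X θ) := by
  obtain ⟨hq, hN⟩ := reframe_null_spec O P θ
  have hp := horo_pos O P θ
  rw [comesFromIdealPoint_iff] at h
  have hv := vol_null O P X θ
  rw [← vol_reframe O P, reframe_vec, reframe_vec, vec_self] at hv
  simp only [LVec.form, LVec.vol, null, Real.sin_add_pi, Real.cos_add_pi] at h hv hq hN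
  unfold lineFn
  set N := reframe O P ⟨1 - Real.sin θ, Real.cos θ, 1 + Real.sin θ⟩
  have e := Real.sin_sq_add_cos_sq β
  -- A vanishing sum of two squares: as seen from `P`, the ideal point lies exactly in the direction
  -- opposite to `β`.
  have hsq : (N.b + horo O P θ * Real.cos β) ^ 2 + ((N.c - N.a) / 2 + horo O P θ * Real.sin β) ^ 2 = 0 := by
    rw [← hq]
    linear_combination 2 * ((N.a + N.c) / 2) * h - hN + ((N.a + N.c) / 2) ^ 2 * e
  have h1 : N.b + horo O P θ * Real.cos β = 0 := by
    apply pow_eq_zero_iff two_ne_zero |>.1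
    nlinarith [sq_nonneg (N.b + horo O P θ * Real.cos β), sq_nonneg ((N.c - N.a) / 2 + horo O P θ * Real.sin β)]
  have h2 : (N.c - N.a) / 2 + horo O P θ * Real.sin β = 0 := by
    apply pow_eq_zero_iff two_ne_zero |>.1
    nlinarith [sq_nonneg (N.b + horo O P θ * Real.cos β), sq_nonneg ((N.c - N.a) / 2 + horo O P θ * Real.sin β)]
  apply mul_left_cancel₀ hp.ne'
  rw [← mul_assoc, ← hv]
  linear_combination ((vec P X).c - (vec P X).a) / 2 * h1 - (vec P X).b * h2

/-- By `lineFn_eq` and positivity of `horo`, lying to the left of a line from the ideal point means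
having at most its slope. -/
theorem isRightSupport_iff {K : Set ℍ} {O P : ℍ} {θ β : ℝ} : IsRightSupport K O θ P β ↔
    P ∈ K ∧ ComesFromIdealPoint O θ P β ∧ ∀ X ∈ K, horoSlope O X θ ≤ horoSlope O P θ := by
  unfold IsRightSupport
  refine and_congr_right fun _ => and_congr_right fun hc => forall₂_congr fun X _ => ?_
  rw [mem_leftHalfPlane_iff, lineFn_eq hc, mul_nonneg_iff_of_pos_left (horo_pos O X θ), sub_nonneg]

/-- A contact point of a support line is a boundary point. -/
theorem IsRightSupport.mem_frontier {K : Set ℍ} {O P : ℍ} {θ β : ℝ} (h : IsRightSupport K O θ P β) :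
    P ∈ frontier K := by
  refine ⟨subset_closure h.1, fun hi => ?_⟩
  have hc : Filter.Tendsto (geodesic P (β - Real.pi / 2)) (nhdsWithin 0 (Set.Ioi 0)) (nhds P) := by
    have := (isometry_geodesic P (β - Real.pi / 2)).continuous.tendsto 0
    rw [geodesic_zero] at this
    exact this.mono_left nhdsWithin_le_nhds
  obtain ⟨s, hs, hs0⟩ := ((hc.eventually (mem_interior_iff_mem_nhds.1 hi)).and
    self_mem_nhdsWithin).exists
  have := (mem_leftHalfPlane_iff P β _).1 (h.2.2 hs)
  rw [lineFn_geodesic, show β - Real.pi / 2 - β = -(Real.pi / 2) by ring, Real.sin_neg,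
    Real.sin_pi_div_two] at this
  have := Real.sinh_pos_iff.2 hs0
  linarith

/-! ### Comparing two points from the ideal points. -/

/-- The radial unit vector in the direction `θ`. -/
def radial (θ : ℝ) : LVec := ⟨-Real.sin θ, Real.cos θ, Real.sin θ⟩

/-- The normalization of `vec O X`, written in terms of its pairings with `null`, `dnull` and
`radial`. -/
theorem horo_mul_radial (O X : ℍ) (θ : ℝ) :
    horo O X θ * (horo O X θ - 2 * (vec O X).form (radial θ)) = 1 + (vec O X).form (dnull θ) ^ 2 := by
  have hX := vec_norm O X
  have e := Real.sin_sq_add_cos_sq θ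
  simp only [horo, LVec.form, null, dnull, radial]
  linear_combination hX - ((vec O X).b ^ 2 + ((vec O X).c - (vec O X).a) ^ 2 / 4) * e

/-- This is the half-plane distance formula with the ideal point at infinity and heights `1 / horo`.
-/
theorem two_mul_cosh_mul_horo (O X Y : ℍ) (θ : ℝ) :
    2 * Real.cosh (dist X Y) * (horo O X θ * horo O Y θ) =
      horo O X θ ^ 2 + horo O Y θ ^ 2 + (vec O X).vol (vec O Y) (null θ) ^ 2 := by
  have h1 := horo_mul_radial O X θ
  have h2 := horo_mul_radial O Y θ
  have h3 : (vec O X).form (vec O Y) = horo O X θ * horo O Y θ - horo O X θ * (vec O Y).form (radial θ) -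
      horo O Y θ * (vec O X).form (radial θ) - (vec O X).form (dnull θ) * (vec O Y).form (dnull θ) := by
    simp only [horo, LVec.form, null, dnull, radial]
    linear_combination ((vec O X).b * (vec O Y).b +
      ((vec O X).c - (vec O X).a) * ((vec O Y).c - (vec O Y).a) / 4) * Real.sin_sq_add_cos_sq θ
  rw [← form_vec O, h3, vol_null]
  rw [form_dnull, form_dnull] at *
  linear_combination horo O X θ ^ 2 * h2 + horo O Y θ ^ 2 * h1

theorem vol_dnull (O X Y : ℍ) (θ : ℝ) : (vec O X).vol (vec O Y) (dnull θ) =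
    horo O Y θ * (vec O X).form (radial θ) - horo O X θ * (vec O Y).form (radial θ) := by
  simp only [horo, LVec.form, LVec.vol, null, dnull, radial]
  ring

/-- On a common line through the ideal point, the sign of this volume tells which point is nearer to
it. -/
theorem two_mul_vol_dnull {O X Y : ℍ} {θ : ℝ} (h : horoSlope O X θ = horoSlope O Y θ) :
    2 * (vec O X).vol (vec O Y) (dnull θ) * (horo O X θ * horo O Y θ) =
      horo O X θ ^ 2 - horo O Y θ ^ 2 := by
  have h1 := horo_mul_radial O X θ
  have h2 := horo_mul_radial O Y θ
  rw [form_dnull] at h1 h2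
  rw [vol_dnull]
  rw [h] at h1
  linear_combination horo O X θ ^ 2 * h2 - horo O Y θ ^ 2 * h1

theorem horo_mul_vol {O X Y : ℍ} {θ : ℝ} (h : horoSlope O X θ = horoSlope O Y θ) (Z : ℍ) :
    (vec O X).vol (vec O Y) (vec O Z) =
      horo O Z θ * (horoSlope O Z θ - horoSlope O X θ) * (vec O X).vol (vec O Y) (dnull θ) := by
  have hid : horo O X θ * (vec O X).vol (vec O Y) (vec O Z) =
      (vec O X).vol (vec O Y) (null θ) * (vec O X).vol (vec O Z) (dnull θ) -
      (vec O X).vol (vec O Z) (null θ) * (vec O X).vol (vec O Y) (dnull θ) := by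
    have e := Real.sin_sq_add_cos_sq θ
    simp only [horo, LVec.form, LVec.vol, null, dnull]
    linear_combination (-((vec O X).a + (vec O X).c) / 4 *
      ((vec O X).a * ((vec O Y).b * (vec O Z).c - (vec O Z).b * (vec O Y).c) -
      (vec O X).b * ((vec O Y).a * (vec O Z).c - (vec O Z).a * (vec O Y).c) +
      (vec O X).c * ((vec O Y).a * (vec O Z).b - (vec O Z).a * (vec O Y).b))) * e
  rw [vol_null, vol_null, h] at hid
  apply mul_left_cancel₀ (horo_pos O X θ).ne'
  rw [hid, h]
  ring

/-- As seen from the ideal points, `X` is ahead of `Y` exactly between the angles `s` and `t`.  The ideal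
points at `s` and `t` are the ends of the line through `X` and `Y`. -/
structure Switch (O X Y : ℍ) (s t : ℝ) : Prop where
  lt : s < t
  lt_add : t < s + 2 * Real.pi
  slope_left : horoSlope O X s = horoSlope O Y s
  slope_right : horoSlope O X t = horoSlope O Y t
  slope_lt : ∀ θ ∈ Set.Ioo s t, horoSlope O Y θ < horoSlope O X θ
  lt_slope : ∀ θ ∈ Set.Ioo t (s + 2 * Real.pi), horoSlope O X θ < horoSlope O Y θ
  log_left : Real.log (horo O X s) - Real.log (horo O Y s) = dist X Y
  log_right : Real.log (horo O Y t) - Real.log (horo O X t) = dist X Y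
  left_of_vol : ∀ Z, (vec O X).vol (vec O Y) (vec O Z) < 0 → horoSlope O Z s < horoSlope O X s
  right_of_vol : ∀ Z, (vec O X).vol (vec O Y) (vec O Z) < 0 → horoSlope O X t < horoSlope O Z t

theorem log_sub_log_horo {O X Y : ℍ} {θ : ℝ} (h : horoSlope O X θ = horoSlope O Y θ)
    (h' : (vec O X).vol (vec O Y) (dnull θ) < 0) :
    Real.log (horo O Y θ) - Real.log (horo O X θ) = dist X Y := by
  have hX := horo_pos O X θ
  have hY := horo_pos O Y θ
  have h1 := two_mul_vol_dnull h
  have h2 := two_mul_cosh_mul_horo O X Y θ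
  rw [vol_null, h, sub_self, mul_zero] at h2
  have hlt : horo O X θ < horo O Y θ := by
    apply lt_of_pow_lt_pow_left₀ 2 hY.le
    have := mul_neg_of_neg_of_pos h' (mul_pos hX hY)
    linarith
  have hlog : 0 ≤ Real.log (horo O Y θ) - Real.log (horo O X θ) :=
    sub_nonneg.2 (Real.log_le_log hX hlt.le)
  rw [← abs_of_nonneg hlog, ← abs_of_nonneg (dist_nonneg (x := X) (y := Y))]
  have hcosh : Real.cosh (Real.log (horo O Y θ) - Real.log (horo O X θ)) = Real.cosh (dist X Y) := by
    rw [Real.cosh_eq, neg_sub, Real.exp_sub, Real.exp_sub, Real.exp_log hX, Real.exp_log hY]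
    field_simp
    linarith
  exact le_antisymm (Real.cosh_le_cosh.1 hcosh.le) (Real.cosh_le_cosh.1 hcosh.ge)

/-- As a function of `θ`, `(vec O X).vol (vec O Y) (null θ)` is a sinusoid plus a constant, `R (cos
(θ - ψ) - cos ω)`; its sign compares the slopes. -/
theorem exists_switch_aux (O : ℍ) {X Y : ℍ} (hXY : X ≠ Y) : ∃ s t, Switch O X Y s t := by
  set U1 := (vec O X).b * (vec O Y).c - (vec O X).c * (vec O Y).b with hU1
  set U2 := -((vec O X).a * (vec O Y).c - (vec O X).c * (vec O Y).a) with hU2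
  set U3 := (vec O X).a * (vec O Y).b - (vec O X).b * (vec O Y).a with hU3
  set C := (U1 + U3) / 2 with hC
  obtain ⟨R, ψ, hR, h1, h2⟩ := exists_polar (U2 / 2) ((U3 - U1) / 2)
  have hd : 0 < Real.sinh (dist X Y) := Real.sinh_pos_iff.2 (dist_pos.2 hXY)
  -- The Gram determinant of the two vectors makes the amplitude exceed the constant, so there are
  -- exactly two zeros per turn.
  have hR2 : R ^ 2 = C ^ 2 + Real.sinh (dist X Y) ^ 2 := by
    have hU : U2 ^ 2 / 4 - U1 * U3 = Real.sinh (dist X Y) ^ 2 := by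
      rw [Real.sinh_sq, ← form_vec O]
      have hX := vec_norm O X
      have hY := vec_norm O Y
      simp only [LVec.form, hU1, hU2, hU3]
      linear_combination ((vec O Y).b ^ 2 - (vec O Y).a * (vec O Y).c) * hX - hY
    linear_combination (-R ^ 2) * Real.sin_sq_add_cos_sq ψ - (U2 / 2 + R * Real.cos ψ) * h1 -
      ((U3 - U1) / 2 + R * Real.sin ψ) * h2 + hU
  have hR0 : 0 < R := lt_of_le_of_ne hR (by rintro rfl; nlinarith [sq_nonneg C])
  have hCR : |C / R| < 1 := by
    rw [abs_div, abs_of_pos hR0, div_lt_one hR0]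
    exact abs_lt_of_sq_lt_sq (by nlinarith) hR
  obtain ⟨hC1, hC2⟩ := abs_lt.1 hCR
  set ω := Real.arccos (-(C / R)) with hω
  have hcos : R * Real.cos ω = -C := by
    rw [hω, Real.cos_arccos (by linarith) (by linarith)]
    field_simp
  have hω0 : 0 < ω := Real.arccos_pos.2 (by linarith)
  have hωπ : ω < Real.pi := by
    refine lt_of_le_of_ne (Real.arccos_le_pi _) fun h => ?_
    rw [Real.arccos_eq_pi] at h
    linarith
  have hsin : 0 < Real.sin ω := Real.sin_pos_of_pos_of_lt_pi hω0 hωπ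
  have hg : ∀ θ, (vec O X).vol (vec O Y) (null θ) = R * (Real.cos (θ - ψ) - Real.cos ω) := by
    intro θ
    rw [mul_sub, hcos, Real.cos_sub]
    simp only [LVec.vol, null]
    linear_combination Real.cos θ * h1 + Real.sin θ * h2
  have hg' : ∀ θ, (vec O X).vol (vec O Y) (dnull θ) = -(R * Real.sin (θ - ψ)) := by
    intro θ
    rw [Real.sin_sub]
    simp only [LVec.vol, dnull]
    linear_combination Real.cos θ * h2 - Real.sin θ * h1
  have hp : ∀ θ, 0 < horo O X θ * horo O Y θ := fun θ => mul_pos (horo_pos O X θ) (horo_pos O Y θ)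
  have hzero : ∀ θ, Real.cos (θ - ψ) = Real.cos ω → horoSlope O X θ = horoSlope O Y θ := by
    intro θ h
    have := hg θ
    rw [vol_null, h, sub_self, mul_zero] at this
    exact sub_eq_zero.1 ((mul_eq_zero.1 this).resolve_left (hp θ).ne')
  have hs0 : horoSlope O X (ψ - ω) = horoSlope O Y (ψ - ω) := hzero _ (by simp)
  have ht0 : horoSlope O X (ψ + ω) = horoSlope O Y (ψ + ω) := hzero _ (by simp)
  have hs1 : 0 < (vec O X).vol (vec O Y) (dnull (ψ - ω)) := by
    rw [hg', show ψ - ω - ψ = -ω by ring, Real.sin_neg, mul_neg, neg_neg]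
    exact mul_pos hR0 hsin
  have ht1 : (vec O X).vol (vec O Y) (dnull (ψ + ω)) < 0 := by
    rw [hg', show ψ + ω - ψ = ω by ring]
    exact neg_neg_of_pos (mul_pos hR0 hsin)
  refine ⟨ψ - ω, ψ + ω, ⟨by linarith, by linarith, hs0, ht0, ?_, ?_, ?_, ?_, ?_, ?_⟩⟩
  · rintro θ ⟨h3, h4⟩
    have : 0 < (vec O X).vol (vec O Y) (null θ) := by
      rw [hg, ← Real.cos_abs (θ - ψ)]
      apply mul_pos hR0 (sub_pos.2 _)
      exact Real.cos_lt_cos_of_nonneg_of_le_pi (abs_nonneg _) hωπ.le (abs_lt.2 ⟨by linarith, by linarith⟩)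
    rw [vol_null] at this
    exact sub_pos.1 (pos_of_mul_pos_right this (hp θ).le)
  · rintro θ ⟨h3, h4⟩
    have : (vec O X).vol (vec O Y) (null θ) < 0 := by
      rw [hg]
      apply mul_neg_of_pos_of_neg hR0 (sub_neg.2 _)
      rcases le_total (θ - ψ) Real.pi with h5 | h5
      · exact Real.cos_lt_cos_of_nonneg_of_le_pi hω0.le h5 (by linarith)
      · rw [← Real.cos_two_pi_sub (θ - ψ)]
        exact Real.cos_lt_cos_of_nonneg_of_le_pi hω0.le (by linarith) (by linarith)
    rw [vol_null] at this
    exact sub_neg.1 (neg_of_mul_neg_right this (hp θ).le)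
  · rw [dist_comm]
    apply log_sub_log_horo hs0.symm
    have : (vec O Y).vol (vec O X) (dnull (ψ - ω)) = -(vec O X).vol (vec O Y) (dnull (ψ - ω)) := by
      simp only [LVec.vol]
      ring
    linarith
  · exact log_sub_log_horo ht0 ht1
  · intro Z hZ
    rw [horo_mul_vol hs0] at hZ
    exact sub_neg.1 (neg_of_mul_neg_right (neg_of_mul_neg_left hZ hs1.le) (horo_pos O Z _).le)
  · intro Z hZ
    rw [horo_mul_vol ht0] at hZ
    by_contra hn
    exact absurd hZ (not_lt.2 (mul_nonneg_of_nonpos_of_nonpos (mul_nonpos_of_nonneg_of_nonpos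
      (horo_pos O Z _).le (by linarith)) ht1.le))

theorem horo_add_int (O X : ℍ) (θ : ℝ) (k : ℤ) : horo O X (θ + k * (2 * Real.pi)) = horo O X θ :=
  (horo_periodic O X).int_mul k θ

theorem horoSlope_add_int (O X : ℍ) (θ : ℝ) (k : ℤ) :
    horoSlope O X (θ + k * (2 * Real.pi)) = horoSlope O X θ :=
  (horoSlope_periodic O X).int_mul k θ

theorem Switch.shift {O X Y : ℍ} {s t : ℝ} (h : Switch O X Y s t) (k : ℤ) :
    Switch O X Y (s + k * (2 * Real.pi)) (t + k * (2 * Real.pi)) where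
  lt := by linarith [h.lt]
  lt_add := by linarith [h.lt_add]
  slope_left := by simpa only [horoSlope_add_int] using h.slope_left
  slope_right := by simpa only [horoSlope_add_int] using h.slope_right
  slope_lt := by
    rintro θ ⟨h1, h2⟩
    have := h.slope_lt (θ - k * (2 * Real.pi)) ⟨by linarith, by linarith⟩
    rwa [← horoSlope_add_int O X _ k, ← horoSlope_add_int O Y _ k, sub_add_cancel] at this
  lt_slope := by
    rintro θ ⟨h1, h2⟩
    have := h.lt_slope (θ - k * (2 * Real.pi)) ⟨by linarith, by linarith⟩
    rwa [← horoSlope_add_int O X _ k, ← horoSlope_add_int O Y _ k, sub_add_cancel] at this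
  log_left := by simpa only [horo_add_int] using h.log_left
  log_right := by simpa only [horo_add_int] using h.log_right
  left_of_vol := by simpa only [horoSlope_add_int] using h.left_of_vol
  right_of_vol := by simpa only [horoSlope_add_int] using h.right_of_vol

theorem exists_switch (O : ℍ) {X Y : ℍ} (hXY : X ≠ Y) (θ : ℝ) :
    ∃ s t, s ∈ Set.Ico θ (θ + 2 * Real.pi) ∧ Switch O X Y s t := by
  obtain ⟨s, t, h⟩ := exists_switch_aux O hXY
  obtain ⟨δ, hδ, k, hk⟩ := exists_angle_near θ s
  refine ⟨_, _, ?_, h.shift (-k)⟩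
  rw [hk]
  push_cast
  exact ⟨by linarith [hδ.1], by linarith [hδ.2]⟩

theorem Switch.slope_le {O X Y : ℍ} {s t : ℝ} (h : Switch O X Y s t) {θ : ℝ} (hθ : θ ∈ Set.Icc s t) :
    horoSlope O Y θ ≤ horoSlope O X θ := by
  rcases hθ.1.eq_or_lt with rfl | h1
  · exact h.slope_left.ge
  rcases hθ.2.eq_or_lt with rfl | h2
  · exact h.slope_right.ge
  exact (h.slope_lt θ ⟨h1, h2⟩).le

theorem Switch.le_slope {O X Y : ℍ} {s t : ℝ} (h : Switch O X Y s t) {θ : ℝ}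
    (hθ : θ ∈ Set.Icc t (s + 2 * Real.pi)) : horoSlope O X θ ≤ horoSlope O Y θ := by
  rcases hθ.1.eq_or_lt with rfl | h1
  · exact h.slope_right.le
  rcases hθ.2.eq_or_lt with rfl | h2
  · rw [horoSlope_periodic, horoSlope_periodic]
    exact h.slope_left.le
  exact (h.lt_slope θ ⟨h1, h2⟩).le

theorem Switch.le_slope_before {O X Y : ℍ} {s t : ℝ} (h : Switch O X Y s t) {θ : ℝ}
    (hθ : θ ∈ Set.Icc (t - 2 * Real.pi) s) : horoSlope O X θ ≤ horoSlope O Y θ := by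
  have := h.le_slope (θ := θ + 2 * Real.pi) ⟨by linarith [hθ.1], by linarith [hθ.2]⟩
  rwa [horoSlope_periodic, horoSlope_periodic] at this

/-! ### Integrals of the maximal slope of two and three points. -/

theorem intervalIntegrable_horoSlope (O X : ℍ) (s t : ℝ) :
    IntervalIntegrable (horoSlope O X) MeasureTheory.volume s t :=
  (continuous_horoSlope_right O X).intervalIntegrable s t

theorem integral_horoSlope (O X : ℍ) (s t : ℝ) :
    ∫ θ in s..t, horoSlope O X θ = Real.log (horo O X s) - Real.log (horo O X t) := by
  rw [intervalIntegral.integral_eq_sub_of_hasDerivAt (fun θ _ => hasDerivAt_log_horo O X θ)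
    (intervalIntegrable_horoSlope O X s t)]
  ring

theorem integral_horoSlope_period (O X : ℍ) : ∫ θ in (0 : ℝ)..2 * Real.pi, horoSlope O X θ = 0 := by
  rw [integral_horoSlope]
  have := horo_periodic O X 0
  rw [zero_add] at this
  rw [this, sub_self]

theorem integral_eq_of_eqOn {O X : ℍ} {F : ℝ → ℝ} {s t : ℝ} (hst : s ≤ t)
    (h : ∀ θ ∈ Set.Icc s t, F θ = horoSlope O X θ) :
    ∫ θ in s..t, F θ = Real.log (horo O X s) - Real.log (horo O X t) := by
  rw [← integral_horoSlope]
  apply intervalIntegral.integral_congr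
  intro θ hθ
  rw [Set.uIcc_of_le hst] at hθ
  exact h θ hθ

theorem integral_max_two (O X Y : ℍ) :
    ∫ θ in (0 : ℝ)..2 * Real.pi, max (horoSlope O X θ) (horoSlope O Y θ) = 2 * dist X Y := by
  rcases eq_or_ne X Y with rfl | hXY
  · simp [integral_horoSlope_period]
  obtain ⟨s, t, -, h⟩ := exists_switch O hXY 0
  have hper : Function.Periodic (fun θ => max (horoSlope O X θ) (horoSlope O Y θ)) (2 * Real.pi) := by
    intro θ
    simp only [horoSlope_periodic O X θ, horoSlope_periodic O Y θ]
  have hint : ∀ a b, IntervalIntegrable (fun θ => max (horoSlope O X θ) (horoSlope O Y θ))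
      MeasureTheory.volume a b := fun a b =>
    ((continuous_horoSlope_right O X).max (continuous_horoSlope_right O Y)).intervalIntegrable a b
  have h0 := hper.intervalIntegral_add_eq 0 s
  rw [zero_add] at h0
  rw [h0, ← intervalIntegral.integral_add_adjacent_intervals (hint s t) (hint t _),
    integral_eq_of_eqOn (O := O) (X := X) h.lt.le fun θ hθ => max_eq_left (h.slope_le hθ),
    integral_eq_of_eqOn (O := O) (X := Y) h.lt_add.le fun θ hθ => max_eq_right (h.le_slope hθ),
    horo_periodic]
  linarith [h.log_left, h.log_right]

/-- The point `a` is strictly to the left of the line from `s` to `t` through `b` and `c`. So it is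
behind `c` at `s` and ahead of it at `t`, and must overtake `c` in between. -/
theorem Switch.succ {O a b c : ℍ} (hv : 0 < (vec O a).vol (vec O b) (vec O c)) {s t s' t' : ℝ}
    (h : Switch O c b s t) (h' : Switch O a c s' t') (hs : s' ∈ Set.Ico s (s + 2 * Real.pi)) :
    s < s' ∧ s' ≤ t ∧ t' ≤ s + 2 * Real.pi := by
  have hv' : (vec O c).vol (vec O b) (vec O a) < 0 := by
    have : (vec O c).vol (vec O b) (vec O a) = -(vec O a).vol (vec O b) (vec O c) := by
      simp only [LVec.vol]
      ring
    linarith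
  have h1 := h.left_of_vol a hv'
  have h2 := h.right_of_vol a hv'
  have hlt : s < s' := by
    rcases hs.1.eq_or_lt with rfl | hlt
    · exact absurd h'.slope_left h1.ne
    · exact hlt
  have h3 : t' ≤ s + 2 * Real.pi := by
    by_contra hn
    have := h'.slope_lt (s + 2 * Real.pi) ⟨by linarith [hs.2], by linarith⟩
    rw [horoSlope_periodic, horoSlope_periodic] at this
    exact this.not_gt h1
  refine ⟨hlt, ?_, h3⟩
  by_contra hn
  have := h'.le_slope (θ := t + 2 * Real.pi) ⟨by linarith [h.lt], by linarith⟩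
  rw [horoSlope_periodic, horoSlope_periodic] at this
  exact this.not_gt h2

theorem vol_rotate (u v w : LVec) : v.vol w u = u.vol v w := by
  simp only [LVec.vol]
  ring

theorem ne_of_vol_pos {O a b c : ℍ} (hv : 0 < (vec O a).vol (vec O b) (vec O c)) : a ≠ b := by
  rintro rfl
  simp only [LVec.vol] at hv
  linarith

/-- The lead passes from `c` to `a` to `b` and back to `c`. Each change contributes the length of
the corresponding side. -/
theorem integral_max_three {O a b c : ℍ} (hv : 0 < (vec O a).vol (vec O b) (vec O c)) :
    ∫ θ in (0 : ℝ)..2 * Real.pi, max (max (horoSlope O a θ) (horoSlope O b θ)) (horoSlope O c θ) =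
      dist a b + dist b c + dist c a := by
  have hv1 : 0 < (vec O b).vol (vec O c) (vec O a) := by rwa [vol_rotate]
  have hv2 : 0 < (vec O c).vol (vec O a) (vec O b) := by rwa [vol_rotate]
  obtain ⟨s, t, -, h⟩ := exists_switch O (ne_of_vol_pos hv1).symm 0
  obtain ⟨s', t', hs', h'⟩ := exists_switch O (ne_of_vol_pos hv2).symm s
  obtain ⟨s'', t'', hs'', h''⟩ := exists_switch O (ne_of_vol_pos hv).symm s'
  obtain ⟨h1, h2, h3⟩ := h.succ hv h' hs'
  obtain ⟨h4, h5, h6⟩ := h'.succ hv1 (by simpa using h'') hs''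
  -- The shift by one turn closes the cycle: after `b` the lead returns to `c` at `s + 2π`.
  obtain ⟨h7, h8, h9⟩ := h''.succ hv2 (h.shift 1) (by constructor <;> push_cast <;> linarith)
  push_cast at h7 h8 h9
  have hper : Function.Periodic
      (fun θ => max (max (horoSlope O a θ) (horoSlope O b θ)) (horoSlope O c θ)) (2 * Real.pi) := by
    intro θ
    simp only [horoSlope_periodic O a θ, horoSlope_periodic O b θ, horoSlope_periodic O c θ]
  have hint : ∀ u v, IntervalIntegrable
      (fun θ => max (max (horoSlope O a θ) (horoSlope O b θ)) (horoSlope O c θ))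
      MeasureTheory.volume u v := fun u v =>
    (((continuous_horoSlope_right O a).max (continuous_horoSlope_right O b)).max
      (continuous_horoSlope_right O c)).intervalIntegrable u v
  have h0 := hper.intervalIntegral_add_eq 0 s
  rw [zero_add] at h0
  rw [h0, ← intervalIntegral.integral_add_adjacent_intervals (hint s s') (hint s' _),
    ← intervalIntegral.integral_add_adjacent_intervals (hint s' s'') (hint s'' _),
    integral_eq_of_eqOn (O := O) (X := c) h1.le fun θ hθ => max_eq_right (max_le
      (h'.le_slope_before ⟨by linarith [hθ.1], hθ.2⟩) (h.slope_le ⟨hθ.1, by linarith [hθ.2]⟩)),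
    integral_eq_of_eqOn (O := O) (X := a) h4.le fun θ hθ => by
      rw [max_eq_left (h''.le_slope_before ⟨by linarith [hθ.1], hθ.2⟩),
        max_eq_left (h'.slope_le ⟨hθ.1, by linarith [hθ.2]⟩)],
    integral_eq_of_eqOn (O := O) (X := b) (by linarith) fun θ hθ => by
      rw [max_eq_right (h''.slope_le ⟨hθ.1, by linarith [hθ.2]⟩),
        max_eq_left (h.le_slope ⟨by linarith [hθ.1], hθ.2⟩)],
    horo_periodic]
  have e1 := h.log_left
  have e2 := h'.log_left
  have e3 := h''.log_left
  rw [dist_comm] at e1 e2 e3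
  linarith

/-! ### Linear inequalities and convex polygons. -/

/-- For a fixed angle and level `m` this is linear in `vec O X`, and it vanishes on a line through the
ideal point. -/
def levelGap (O : ℍ) (θ m : ℝ) (X : ℍ) : ℝ := horo O X θ * (m - horoSlope O X θ)

theorem levelGap_self (O X : ℍ) (θ : ℝ) : levelGap O θ (horoSlope O X θ) X = 0 := by
  simp [levelGap]

theorem levelGap_nonneg_iff {O X : ℍ} {θ m : ℝ} : 0 ≤ levelGap O θ m X ↔ horoSlope O X θ ≤ m := by
  rw [levelGap, mul_nonneg_iff_of_pos_left (horo_pos O X θ), sub_nonneg]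

theorem levelGap_pos_iff {O X : ℍ} {θ m : ℝ} : 0 < levelGap O θ m X ↔ horoSlope O X θ < m := by
  rw [levelGap, mul_pos_iff_of_pos_left (horo_pos O X θ), sub_pos]

theorem levelGap_eq (O : ℍ) (θ m : ℝ) (X : ℍ) :
    levelGap O θ m X = (vec O X).form (null θ) * m + (vec O X).form (dnull θ) := by
  rw [form_dnull, levelGap, horo]
  ring

/-- Cramer's rule for the vector of `x` in terms of those of `a`, `b`, `c`, followed by the linear
functional `levelGap`. -/
theorem vol_mul_levelGap (O : ℍ) (θ m : ℝ) (a b c x : ℍ) :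
    (vec O a).vol (vec O b) (vec O c) * levelGap O θ m x =
      (vec O x).vol (vec O b) (vec O c) * levelGap O θ m a +
      (vec O a).vol (vec O x) (vec O c) * levelGap O θ m b +
      (vec O a).vol (vec O b) (vec O x) * levelGap O θ m c := by
  simp only [levelGap_eq, LVec.form, LVec.vol]
  ring

/-- The linear relation between three coplanar vectors, with coefficients obtained by pairing their
cross products with `null θ`. -/
theorem vol_null_mul_levelGap {O a b c : ℍ} (h : (vec O a).vol (vec O b) (vec O c) = 0) (θ θ' m : ℝ) :
    (vec O b).vol (vec O c) (null θ) * levelGap O θ' m a +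
      (vec O c).vol (vec O a) (null θ) * levelGap O θ' m b +
      (vec O a).vol (vec O b) (null θ) * levelGap O θ' m c = 0 := by
  have : (vec O a).vol (vec O b) (vec O c) * ((null θ).form (null θ') * m + (null θ).form (dnull θ')) =
      (vec O b).vol (vec O c) (null θ) * levelGap O θ' m a +
      (vec O c).vol (vec O a) (null θ) * levelGap O θ' m b +
      (vec O a).vol (vec O b) (null θ) * levelGap O θ' m c := by
    simp only [levelGap_eq, LVec.form, LVec.vol]
    ring
  rw [← this, h, zero_mul]

theorem vol_swap_left (u v w : LVec) : v.vol u w = -u.vol v w := by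
  simp only [LVec.vol]
  ring

theorem vol_swap_right (u v w : LVec) : u.vol w v = -u.vol v w := by
  simp only [LVec.vol]
  ring

theorem continuous_partialSups_horoSlope (O : ℍ) (p : ℕ → ℍ) (n : ℕ) :
    Continuous (partialSups (fun i => horoSlope O (p i)) n) := by
  induction n with
  | zero => simpa using continuous_horoSlope_right O (p 0)
  | succ n ih =>
    rw [partialSups_add_one]
    exact ih.sup (continuous_horoSlope_right O _)

theorem partialSups_horoSlope_le_iff {O : ℍ} {p : ℕ → ℍ} {n : ℕ} {θ m : ℝ} :
    partialSups (fun i => horoSlope O (p i)) n θ ≤ m ↔ ∀ i ≤ n, horoSlope O (p i) θ ≤ m := by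
  rw [Pi.partialSups_apply, partialSups_le_iff]

/-- The perimeter of a convex polygon. -/
theorem integral_partialSups (O : ℍ) (p : ℕ → ℍ) (n : ℕ)
    (hv : ∀ i j k, i < j → j < k → k ≤ n → 0 < (vec O (p i)).vol (vec O (p j)) (vec O (p k))) :
    ∫ θ in (0 : ℝ)..2 * Real.pi, partialSups (fun i => horoSlope O (p i)) n θ =
      ∑ i ∈ Finset.range n, dist (p i) (p (i + 1)) + dist (p n) (p 0) := by
  induction n with
  | zero => simp [integral_horoSlope_period]
  | succ n ih =>
    rcases Nat.eq_zero_or_pos n with rfl | hn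
    · have := integral_max_two O (p 0) (p 1)
      simp only [partialSups_add_one, partialSups_zero, Pi.sup_apply]
      simp only [zero_add, Finset.range_one, Finset.sum_singleton, dist_comm (p 1) (p 0)]
      rw [this]
      ring
    have hvn : 0 < (vec O (p 0)).vol (vec O (p n)) (vec O (p (n + 1))) := hv _ _ _ hn n.lt_succ_self le_rfl
    -- The new vertex adds the triangle `p 0`, `p n`, `p (n + 1)` and removes the two-gon on the
    -- chord `p 0`, `p n`, which cancels the chord's length.
    have key : ∀ θ, partialSups (fun i => horoSlope O (p i)) (n + 1) θ =
        partialSups (fun i => horoSlope O (p i)) n θ +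
        (max (max (horoSlope O (p 0) θ) (horoSlope O (p n) θ)) (horoSlope O (p (n + 1)) θ) -
          max (horoSlope O (p 0) θ) (horoSlope O (p n) θ)) := by
      intro θ
      rw [partialSups_add_one, Pi.sup_apply]
      set m := max (horoSlope O (p 0) θ) (horoSlope O (p n) θ) with hm
      have hmM : m ≤ partialSups (fun i => horoSlope O (p i)) n θ :=
        max_le (le_partialSups_of_le (fun i => horoSlope O (p i)) (Nat.zero_le n) θ)
          (le_partialSups (fun i => horoSlope O (p i)) n θ)
      rcases le_total (horoSlope O (p (n + 1)) θ) m with h | h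
      · rw [max_eq_left h, sub_self, add_zero, sup_eq_left]
        exact h.trans hmM
      -- In coordinates with respect to that triangle, an old vertex strictly between `p 0` and `p
      -- n` has a negative coefficient at `p (n + 1)`. If the new vertex is at least level with `m`,
      -- the old one cannot exceed it.
      · have hMm : partialSups (fun i => horoSlope O (p i)) n θ ≤ m := by
          refine partialSups_horoSlope_le_iff.2 fun i hi => ?_
          rcases Nat.eq_zero_or_pos i with rfl | hi0
          · exact le_max_left _ _
          rcases hi.eq_or_lt with rfl | hin
          · exact le_max_right _ _
          have h1 := hv _ _ _ hin n.lt_succ_self le_rfl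
          have h2 := hv _ _ _ hi0 (hin.trans n.lt_succ_self) le_rfl
          have h3 := hv _ _ _ hi0 hin n.le_succ
          have h4 := vol_mul_levelGap O θ m (p 0) (p n) (p (n + 1)) (p i)
          rw [vol_swap_right (vec O (p 0)) (vec O (p i)) (vec O (p n))] at h4
          have h5 : 0 ≤ levelGap O θ m (p 0) := levelGap_nonneg_iff.2 (le_max_left _ _)
          have h6 : 0 ≤ levelGap O θ m (p n) := levelGap_nonneg_iff.2 (le_max_right _ _)
          have h7 : levelGap O θ m (p (n + 1)) ≤ 0 :=
            mul_nonpos_of_nonneg_of_nonpos (horo_pos O _ θ).le (by linarith)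
          apply levelGap_nonneg_iff.1
          apply nonneg_of_mul_nonneg_right _ hvn
          rw [h4]
          have := mul_nonneg_of_nonpos_of_nonpos (neg_nonpos.2 h3.le) h7
          positivity
        have : partialSups (fun i => horoSlope O (p i)) n θ = m := le_antisymm hMm hmM
        rw [this]
        ring
    have hc0 := continuous_horoSlope_right O (p 0)
    have hcn := continuous_horoSlope_right O (p n)
    have hcn' := continuous_horoSlope_right O (p (n + 1))
    have hcP := continuous_partialSups_horoSlope O p n
    simp only [key]
    rw [intervalIntegral.integral_add (hcP.intervalIntegrable _ _)
      (Continuous.intervalIntegrable (by fun_prop) _ _), intervalIntegral.integral_sub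
      (Continuous.intervalIntegrable (by fun_prop) _ _) (Continuous.intervalIntegrable (by fun_prop) _ _),
      ih fun i j k h1 h2 h3 => hv i j k h1 h2 (h3.trans n.le_succ), integral_max_three hvn, integral_max_two,
      Finset.sum_range_succ, dist_comm (p n) (p 0)]
    ring

/-! ### Ordering points in convex position. -/

/-- Every point of `V` is the extreme one as seen from some ideal point. -/
def ConvexPosition (O : ℍ) (V : Finset ℍ) : Prop :=
  ∀ v ∈ V, ∃ θ, ∀ w ∈ V, w ≠ v → horoSlope O w θ < horoSlope O v θ

open Classical in
-- A subset of least cardinality with the same maximal slopes works: a point that never strictly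
-- leads could be erased.
theorem exists_convexPosition (O : ℍ) (F : Finset ℍ) : ∃ V ⊆ F, ConvexPosition O V ∧
    ∀ θ, ∀ X ∈ F, ∃ v ∈ V, horoSlope O X θ ≤ horoSlope O v θ := by
  set S := F.powerset.filter fun V => ∀ θ, ∀ X ∈ F, ∃ v ∈ V, horoSlope O X θ ≤ horoSlope O v θ with hS
  have hF : F ∈ S := by
    simp only [hS, Finset.mem_filter, Finset.mem_powerset]
    exact ⟨subset_rfl, fun θ X hX => ⟨X, hX, le_rfl⟩⟩
  obtain ⟨V, hV, hmin⟩ := S.exists_min_image Finset.card ⟨F, hF⟩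
  have hV' := hV
  simp only [hS, Finset.mem_filter, Finset.mem_powerset] at hV'
  refine ⟨V, hV'.1, fun v hv => ?_, hV'.2⟩
  by_contra hcon
  push Not at hcon
  have : V.erase v ∈ S := by
    simp only [hS, Finset.mem_filter, Finset.mem_powerset]
    refine ⟨(V.erase_subset v).trans hV'.1, fun θ X hX => ?_⟩
    obtain ⟨w, hw, hle⟩ := hV'.2 θ X hX
    rcases eq_or_ne w v with rfl | hwv
    · obtain ⟨w', hw', hne, hle'⟩ := hcon θ
      exact ⟨w', Finset.mem_erase.2 ⟨hne, hw'⟩, hle.trans hle'⟩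
    · exact ⟨w, Finset.mem_erase.2 ⟨hwv, hw⟩, hle⟩
  exact absurd (hmin _ this) (not_le.2 (Finset.card_erase_lt_of_mem hv))

theorem ConvexPosition.exists_levelGap {O : ℍ} {V : Finset ℍ} (h : ConvexPosition O V) {v : ℍ} (hv : v ∈ V) :
    ∃ θ m, levelGap O θ m v = 0 ∧ ∀ w ∈ V, w ≠ v → 0 < levelGap O θ m w := by
  obtain ⟨θ, hθ⟩ := h v hv
  exact ⟨θ, horoSlope O v θ, levelGap_self O v θ, fun w hw hne => levelGap_pos_iff.2 (hθ w hw hne)⟩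

/-- An ideal point favouring `a` gives the linear relation coefficients of opposite signs at `b` and
`c`. Whatever the sign at `a`, a functional vanishing at `c` or at `b` and positive at the other two
points contradicts the relation. -/
theorem ConvexPosition.vol_ne_zero {O : ℍ} {V : Finset ℍ} (h : ConvexPosition O V) {a b c : ℍ} (ha : a ∈ V)
    (hb : b ∈ V) (hc : c ∈ V) (hab : a ≠ b) (hbc : b ≠ c) (hca : c ≠ a) :
    (vec O a).vol (vec O b) (vec O c) ≠ 0 := by
  intro h0
  obtain ⟨θ, hθ⟩ := h a ha
  have hy : (vec O c).vol (vec O a) (null θ) < 0 := by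
    rw [vol_null]
    exact mul_neg_of_pos_of_neg (mul_pos (horo_pos O _ _) (horo_pos O _ _)) (sub_neg.2 (hθ c hc hca))
  have hz : 0 < (vec O a).vol (vec O b) (null θ) := by
    rw [vol_null]
    exact mul_pos (mul_pos (horo_pos O _ _) (horo_pos O _ _)) (sub_pos.2 (hθ b hb hab.symm))
  rcases le_or_gt ((vec O b).vol (vec O c) (null θ)) 0 with hx | hx
  · obtain ⟨θ', m, h1, h2⟩ := h.exists_levelGap hc
    have h3 := vol_null_mul_levelGap h0 θ θ' m
    have h4 := h2 a ha hca.symm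
    have h5 := h2 b hb hbc
    rw [h1] at h3
    nlinarith [mul_nonneg_of_nonpos_of_nonpos hx (neg_nonpos.2 h4.le), mul_neg_of_neg_of_pos hy h5]
  · obtain ⟨θ', m, h1, h2⟩ := h.exists_levelGap hb
    have h3 := vol_null_mul_levelGap h0 θ θ' m
    have h4 := h2 a ha hab
    have h5 := h2 c hc hbc.symm
    rw [h1] at h3
    nlinarith [mul_pos hx h4, mul_pos hz h5]

/-- All other points lie strictly on one side of a line through `o`, so their angular order around
`o` is not cyclic but linear. -/
theorem ConvexPosition.vol_trans {O : ℍ} {V : Finset ℍ} (h : ConvexPosition O V) {o a b c : ℍ} (ho : o ∈ V)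
    (ha : a ∈ V) (hb : b ∈ V) (hc : c ∈ V) (hao : a ≠ o) (hbo : b ≠ o) (hco : c ≠ o)
    (hab : 0 < (vec O o).vol (vec O a) (vec O b)) (hbc : 0 < (vec O o).vol (vec O b) (vec O c)) :
    0 < (vec O o).vol (vec O a) (vec O c) := by
  have hac : a ≠ c := by
    rintro rfl
    rw [vol_swap_right] at hbc
    linarith
  have hne := h.vol_ne_zero ho ha hc hao.symm hac hco
  by_contra hn
  have hlt : (vec O o).vol (vec O a) (vec O c) < 0 := lt_of_le_of_ne (not_lt.1 hn) hne
  obtain ⟨θ, m, h1, h2⟩ := h.exists_levelGap ho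
  have h3 := vol_mul_levelGap O θ m a b c o
  rw [h1, vol_swap_left (vec O o), ← vol_rotate (vec O a) (vec O b) (vec O o),
    ← vol_rotate (vec O b) (vec O o) (vec O a)] at h3
  have h4 := mul_pos hbc (h2 a ha hao)
  have h5 := mul_neg_of_neg_of_pos hlt (h2 b hb hbo)
  have h6 := mul_pos hab (h2 c hc hco)
  linarith

/-- A functional that vanishes at `b` and is positive at `o`, `a`, `c` forces the turn at `b` to
have the same sign as the two turns around `o`. -/
theorem ConvexPosition.vol_pos {O : ℍ} {V : Finset ℍ} (h : ConvexPosition O V) {o a b c : ℍ} (ho : o ∈ V)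
    (ha : a ∈ V) (hb : b ∈ V) (hc : c ∈ V) (hbo : b ≠ o) (hab : a ≠ b) (hbc : b ≠ c)
    (h1 : 0 < (vec O o).vol (vec O a) (vec O b)) (h2 : 0 < (vec O o).vol (vec O b) (vec O c)) :
    0 < (vec O a).vol (vec O b) (vec O c) := by
  obtain ⟨θ, m, h3, h4⟩ := h.exists_levelGap hb
  have h5 := vol_mul_levelGap O θ m o a c b
  rw [h3, vol_swap_left (vec O a) (vec O b)] at h5
  have h6 := mul_pos h2 (h4 a ha hab)
  have h7 := mul_pos h1 (h4 c hc hbc.symm)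
  have h8 := h4 o ho hbo.symm
  by_contra hn
  nlinarith [mul_nonneg (neg_nonneg.2 (not_lt.1 hn)) h8.le]

/-- Points in convex position are the vertices of a convex polygon. -/
theorem ConvexPosition.exists_polygon {O : ℍ} {V : Finset ℍ} (h : ConvexPosition O V) (hV : V.Nonempty) :
    ∃ (n : ℕ) (p : ℕ → ℍ), (∀ i ≤ n, p i ∈ V) ∧ (∀ v ∈ V, ∃ i ≤ n, p i = v) ∧
      ∀ i j k, i < j → j < k → k ≤ n → 0 < (vec O (p i)).vol (vec O (p j)) (vec O (p k)) := by
  classical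
  obtain ⟨o, ho⟩ := hV
  -- Equality is added to make the angular order around `o` total, as sorting requires.
  let r : (V.erase o) → (V.erase o) → Prop :=
    fun x y => x = y ∨ 0 < (vec O o).vol (vec O x) (vec O y)
  have hmem : ∀ x : V.erase o, x.1 ≠ o ∧ x.1 ∈ V := fun x => Finset.mem_erase.1 x.2
  have : Std.Total r := ⟨fun x y => by
    rcases eq_or_ne x y with hxy | hxy
    · exact Or.inl (Or.inl hxy)
    · have hne := h.vol_ne_zero ho (hmem x).2 (hmem y).2 (hmem x).1.symm
        (fun e => hxy (Subtype.ext e)) (hmem y).1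
      rcases lt_or_gt_of_ne hne with hlt | hgt
      · right; right
        rw [vol_swap_right]
        linarith
      · exact Or.inl (Or.inr hgt)⟩
  have : IsTrans _ r := ⟨fun x y z hxy hyz => by
    rcases hxy with rfl | hxy
    · exact hyz
    rcases hyz with rfl | hyz
    · exact Or.inr hxy
    exact Or.inr (h.vol_trans ho (hmem x).2 (hmem y).2 (hmem z).2 (hmem x).1 (hmem y).1 (hmem z).1 hxy hyz)⟩
  let l := (Finset.univ : Finset (V.erase o)).toList.insertionSort r
  have hperm : l.Perm (Finset.univ : Finset (V.erase o)).toList := List.perm_insertionSort r _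
  have hnodup : l.Nodup := hperm.nodup_iff.2 (Finset.nodup_toList _)
  have hsort : l.Pairwise r := List.pairwise_insertionSort r _
  have hl : ∀ x, x ∈ l := fun x => hperm.mem_iff.2 (by simp)
  have hpair : ∀ i j (hi : i < l.length) (hj : j < l.length), i < j →
      0 < (vec O o).vol (vec O l[i]) (vec O l[j]) := fun i j hi hj hij =>
    (List.pairwise_iff_getElem.1 hsort i j hi hj hij).resolve_left fun e =>
      hij.ne ((hnodup.getElem_inj_iff).1 e)
  -- The pivot `o` is vertex zero; its reuse beyond the sorted list is only a default value.
  let p : ℕ → ℍ := fun i => match i with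
    | 0 => o
    | i + 1 => if hi : i < l.length then l[i] else o
  have hp : ∀ i (hi : i < l.length), p (i + 1) = l[i] := fun i hi => dif_pos hi
  refine ⟨l.length, p, ?_, ?_, ?_⟩
  · rintro (_ | i) hi
    · exact ho
    · rw [hp i hi]
      exact (hmem _).2
  · intro v hv
    rcases eq_or_ne v o with rfl | hvo
    · exact ⟨0, Nat.zero_le _, rfl⟩
    · obtain ⟨i, hi, he⟩ := List.getElem_of_mem (hl ⟨v, Finset.mem_erase.2 ⟨hvo, hv⟩⟩)
      exact ⟨i + 1, hi, by rw [hp i hi, he]⟩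
  · rintro (_ | i) (_ | j) (_ | k) hij hjk hk
    · omega
    · omega
    · omega
    · rw [hp j (by omega), hp k (by omega)]
      exact hpair j k _ _ (by omega)
    · omega
    · omega
    · omega
    · have hi' : i < l.length := by omega
      have hj' : j < l.length := by omega
      have hk' : k < l.length := by omega
      rw [hp i hi', hp j hj', hp k hk']
      refine h.vol_pos ho (hmem _).2 (hmem _).2 (hmem _).2 (hmem _).1 ?_ ?_
        (hpair i j hi' hj' (by omega)) (hpair j k hj' hk' (by omega))
      · intro e
        have := (hnodup.getElem_inj_iff).1 (Subtype.ext e)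
        omega
      · intro e
        have := (hnodup.getElem_inj_iff).1 (Subtype.ext e)
        omega

/-! ### The support function and the perimeter. -/

/-- The position, as seen from the ideal point at the angle `θ`, of the right-hand support line. -/
def supportFn (O : ℍ) (K : Set ℍ) (θ : ℝ) : ℝ := sSup ((fun X => horoSlope O X θ) '' K)

theorem continuous_supportFn (O : ℍ) {K : Set ℍ} (hK : IsCompact K) : Continuous (supportFn O K) :=
  hK.continuous_sSup (f := fun θ X => horoSlope O X θ)
    ((continuous_horoSlope O).comp continuous_swap)

theorem supportFn_periodic (O : ℍ) (K : Set ℍ) : Function.Periodic (supportFn O K) (2 * Real.pi) := by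
  intro θ
  simp only [supportFn, horoSlope_periodic O _ θ]

theorem horoSlope_le_supportFn (O : ℍ) {K : Set ℍ} (hK : IsCompact K) {X : ℍ} (hX : X ∈ K) (θ : ℝ) :
    horoSlope O X θ ≤ supportFn O K θ := by
  apply le_csSup _ (Set.mem_image_of_mem _ hX)
  exact (hK.image ((continuous_horoSlope O).comp (Continuous.prodMk_left θ))).bddAbove

theorem exists_isRightSupport (O : ℍ) {K : Set ℍ} (hK : IsCompact K) (hne : K.Nonempty) (θ : ℝ) :
    ∃ P β, IsRightSupport K O θ P β := by
  obtain ⟨P, hP, hmax⟩ := hK.exists_isMaxOn hne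
    ((continuous_horoSlope O).comp (Continuous.prodMk_left θ)).continuousOn
  obtain ⟨β, hβ⟩ := exists_comesFromIdealPoint O P θ
  exact ⟨P, β, isRightSupport_iff.2 ⟨hP, hβ, fun X hX => hmax hX⟩⟩

theorem IsRightSupport.horoSlope_eq {O P : ℍ} {K : Set ℍ} {θ β : ℝ} (h : IsRightSupport K O θ P β) :
    horoSlope O P θ = supportFn O K θ := by
  obtain ⟨h1, -, h2⟩ := isRightSupport_iff.1 h
  have hgr : IsGreatest ((fun X => horoSlope O X θ) '' K) (horoSlope O P θ) := by
    refine ⟨Set.mem_image_of_mem _ h1, ?_⟩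
    rintro _ ⟨X, hX, rfl⟩
    exact h2 X hX
  exact hgr.csSup_eq.symm

theorem IsRightSupport.lineFn_eq {O P : ℍ} {K : Set ℍ} {θ β : ℝ} (h : IsRightSupport K O θ P β) :
    lineFn P β O = supportFn O K θ := by
  rw [HypPlane.lineFn_eq h.2.1, horo_self, horoSlope_self, h.horoSlope_eq, one_mul, sub_zero]

theorem sum_dist_eq {n : ℕ} (q : Fin (n + 1) → ℍ) (p : ℕ → ℍ) (h : ∀ i : Fin (n + 1), q i = p i) :
    ∑ i, edist (q i) (q (i + 1)) =
      ENNReal.ofReal (∑ i ∈ Finset.range n, dist (p i) (p (i + 1)) + dist (p n) (p 0)) := by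
  have h1 : ∑ i, dist (q i) (q (i + 1)) =
      ∑ i ∈ Finset.range n, dist (p i) (p (i + 1)) + dist (p n) (p 0) := by
    rw [Fin.sum_univ_castSucc, Fin.last_add_one, Finset.sum_range]
    simp only [Fin.coeSucc_eq_succ, h]
    simp
  rw [← h1, ENNReal.ofReal_sum_of_nonneg fun _ _ => dist_nonneg]
  simp only [edist_dist]

theorem perimeter_le (O : ℍ) {K : Set ℍ} (hK : IsCompact K) :
    perimeter K ≤ ENNReal.ofReal (∫ θ in (0 : ℝ)..2 * Real.pi, supportFn O K θ) := by
  refine iSup_le fun n => iSup_le fun q => iSup_le fun hq => ?_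
  -- Indices are reduced modulo `n + 1`, so every `p i` is a vertex, while only those up to `n`
  -- enter the sum.
  set p : ℕ → ℍ := fun k => q (Fin.ofNat (n + 1) k) with hp
  have hqp : ∀ i : Fin (n + 1), q i = p i := fun i => by simp [hp]
  have hpm : ∀ i, p i ∈ K := fun i => hK.isClosed.frontier_subset (hq.1 _)
  rw [sum_dist_eq q p hqp, ← integral_partialSups O]
  · apply ENNReal.ofReal_le_ofReal
    apply intervalIntegral.integral_mono_on Real.two_pi_pos.le
      ((continuous_partialSups_horoSlope O p n).intervalIntegrable _ _)
      ((continuous_supportFn O hK).intervalIntegrable _ _)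
    intro θ _
    exact partialSups_horoSlope_le_iff.2 fun i _ => horoSlope_le_supportFn O hK (hpm i) θ
  · intro i j k hij hjk hk
    rw [← counterclockwise_iff]
    have := hq.2 ⟨i, by omega⟩ ⟨j, by omega⟩ ⟨k, by omega⟩ hij hjk
    simpa only [hqp] using this

theorem le_perimeter {O : ℍ} {K : Set ℍ} {n : ℕ} {p : ℕ → ℍ} (hp : ∀ i ≤ n, p i ∈ frontier K)
    (hv : ∀ i j k, i < j → j < k → k ≤ n → 0 < (vec O (p i)).vol (vec O (p j)) (vec O (p k))) :
    ENNReal.ofReal (∫ θ in (0 : ℝ)..2 * Real.pi, partialSups (fun i => horoSlope O (p i)) n θ) ≤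
      perimeter K := by
  rw [integral_partialSups O p n hv, ← sum_dist_eq (fun i : Fin (n + 1) => p i) p fun _ => rfl]
  refine le_iSup_of_le n (le_iSup_of_le (fun i => p i) (le_iSup_of_le ⟨?_, ?_⟩ le_rfl))
  · exact fun i => hp i (by omega)
  · intro i j k hij hjk
    rw [counterclockwise_iff O]
    exact hv i j k hij hjk (by omega)

/-- A contact point for one angle is nearly optimal for nearby angles by continuity; compactness of
the circle of angles leaves finitely many. -/
theorem exists_finset_supportFn_lt (O : ℍ) {K : Set ℍ} (hK : IsCompact K) (hne : K.Nonempty) {ε : ℝ}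
    (hε : 0 < ε) : ∃ F : Finset ℍ, F.Nonempty ∧ (∀ X ∈ F, X ∈ frontier K) ∧
      ∀ θ ∈ Set.Icc 0 (2 * Real.pi), ∃ X ∈ F, supportFn O K θ < horoSlope O X θ + ε := by
  classical
  choose P β hP using exists_isRightSupport O hK hne
  have hopen : ∀ φ, {θ | supportFn O K θ < horoSlope O (P φ) θ + ε} ∈ nhds φ := by
    intro φ
    apply (isOpen_lt (continuous_supportFn O hK)
      ((continuous_horoSlope_right O (P φ)).add continuous_const)).mem_nhds
    show supportFn O K φ < horoSlope O (P φ) φ + ε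
    rw [(hP φ).horoSlope_eq]
    linarith
  obtain ⟨t, -, ht⟩ := (isCompact_Icc (a := (0 : ℝ)) (b := 2 * Real.pi)).elim_nhds_subcover
    (fun φ => {θ | supportFn O K θ < horoSlope O (P φ) θ + ε}) fun φ _ => hopen φ
  have hcov : ∀ θ ∈ Set.Icc 0 (2 * Real.pi), ∃ X ∈ t.image P, supportFn O K θ < horoSlope O X θ + ε := by
    intro θ hθ
    obtain ⟨φ, hφ, hlt⟩ := Set.mem_iUnion₂.1 (ht hθ)
    exact ⟨P φ, Finset.mem_image_of_mem P hφ, hlt⟩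
  refine ⟨t.image P, ?_, ?_, hcov⟩
  · obtain ⟨X, hX, -⟩ := hcov 0 ⟨le_rfl, Real.two_pi_pos.le⟩
    exact ⟨X, hX⟩
  · intro X hX
    obtain ⟨φ, -, rfl⟩ := Finset.mem_image.1 hX
    exact (hP φ).mem_frontier

/-- The perimeter is the integral of the support function over the ideal points. -/
theorem toReal_perimeter (O : ℍ) {K : Set ℍ} (hK : IsCompact K) (hne : K.Nonempty) :
    (perimeter K).toReal = ∫ θ in (0 : ℝ)..2 * Real.pi, supportFn O K θ := by
  have hle := perimeter_le O hK
  have htop : perimeter K ≠ ⊤ := ne_top_of_le_ne_top ENNReal.ofReal_ne_top hle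
  have hint := (continuous_supportFn O hK).intervalIntegrable (μ := MeasureTheory.volume) 0 (2 * Real.pi)
  apply le_antisymm
  -- The integral must be nonnegative: it dominates that of the slope of any point of `K`, which
  -- vanishes over a period.
  · apply ENNReal.toReal_le_of_le_ofReal _ hle
    obtain ⟨X, hX⟩ := hne
    refine (integral_horoSlope_period O X).ge.trans ?_
    exact intervalIntegral.integral_mono_on Real.two_pi_pos.le (intervalIntegrable_horoSlope O X _ _) hint
      fun θ _ => horoSlope_le_supportFn O hK hX θ
  · apply le_of_forall_pos_le_add
    intro ε hε
    obtain ⟨F, hF, hFK, hcov⟩ := exists_finset_supportFn_lt O hK hne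
      (div_pos hε Real.two_pi_pos)
    obtain ⟨V, hVF, hV, hdom⟩ := exists_convexPosition O F
    have hVne : V.Nonempty := by
      obtain ⟨X, hX⟩ := hF
      obtain ⟨v, hv, -⟩ := hdom 0 X hX
      exact ⟨v, hv⟩
    obtain ⟨n, p, hp, hpV, hvol⟩ := hV.exists_polygon hVne
    have hL := le_perimeter (K := K) (fun i hi => hFK _ (hVF (hp i hi))) hvol
    rw [ENNReal.ofReal_le_iff_le_toReal htop] at hL
    have hc := continuous_partialSups_horoSlope O p n
    have : ∫ θ in (0 : ℝ)..2 * Real.pi, supportFn O K θ ≤ ∫ θ in (0 : ℝ)..2 * Real.pi,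
        (partialSups (fun i => horoSlope O (p i)) n θ + ε / (2 * Real.pi)) := by
      apply intervalIntegral.integral_mono_on Real.two_pi_pos.le hint
        ((hc.add continuous_const).intervalIntegrable _ _)
      intro θ hθ
      obtain ⟨X, hX, hlt⟩ := hcov θ hθ
      obtain ⟨v, hv, hXv⟩ := hdom θ X hX
      obtain ⟨i, hi, rfl⟩ := hpV v hv
      have := le_partialSups_of_le (fun i => horoSlope O (p i)) hi θ
      simp only [Pi.add_apply]
      linarith
    rw [intervalIntegral.integral_add (hc.intervalIntegrable _ _)
      (continuous_const.intervalIntegrable _ _), intervalIntegral.integral_const, sub_zero, smul_eq_mul,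
      mul_div_cancel₀ _ Real.two_pi_pos.ne'] at this
    linarith

theorem integral_supportFn_add (O : ℍ) (K : Set ℍ) (θ₀ : ℝ) :
    ∫ φ in (0 : ℝ)..2 * Real.pi, supportFn O K (θ₀ + φ) = ∫ θ in (0 : ℝ)..2 * Real.pi, supportFn O K θ := by
  rw [intervalIntegral.integral_comp_add_left (supportFn O K), add_zero,
    (supportFn_periodic O K).intervalIntegral_add_eq θ₀ 0, zero_add]

end HypPlane

end

open HypPlane in
theorem theorem4p3 (K : Set UpperHalfPlane) (hcompact : IsCompact K) (hconvex : GeodesicallyConvex K)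
    (hne : K.Nonempty) (O : UpperHalfPlane) (θ₀ : ℝ) :
    (∀ φ : ℝ, ∃ (P : UpperHalfPlane) (β α : ℝ),
      IsRightSupport K O (θ₀ + φ) P β ∧ IsNormalAngle O P β α) ∧
    perimeter K ≠ ⊤ ∧
    ∀ (P : ℝ → UpperHalfPlane) (β α : ℝ → ℝ),
      (∀ φ ∈ Set.Icc 0 (2 * Real.pi),
        IsRightSupport K O (θ₀ + φ) (P φ) (β φ) ∧ IsNormalAngle O (P φ) (β φ) (α φ)) →
      IntervalIntegrable (fun φ => Real.sinh (signedDist O (P φ) (β φ))) MeasureTheory.volume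
        0 (2 * Real.pi) ∧
      IntervalIntegrable (fun φ => Real.sinh (dist O (P φ)) * Real.cos (α φ)) MeasureTheory.volume
        0 (2 * Real.pi) ∧
      (perimeter K).toReal = ∫ φ in (0 : ℝ)..2 * Real.pi, Real.sinh (signedDist O (P φ) (β φ)) ∧
      (perimeter K).toReal =
        ∫ φ in (0 : ℝ)..2 * Real.pi, Real.sinh (dist O (P φ)) * Real.cos (α φ) := by
  refine ⟨fun φ => ?_, ne_top_of_le_ne_top ENNReal.ofReal_ne_top (perimeter_le O hcompact), ?_⟩
  · obtain ⟨P, β, h⟩ := exists_isRightSupport O hcompact hne (θ₀ + φ)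
    obtain ⟨α, hα⟩ := exists_isNormalAngle O P β
    exact ⟨P, β, α, h, hα⟩
  intro P β α h
  -- Both integrands agree pointwise with the continuous `supportFn`, so the choice of contact
  -- points and normal angles does not matter.
  have h1 : Set.EqOn (fun φ => supportFn O K (θ₀ + φ)) (fun φ => Real.sinh (signedDist O (P φ) (β φ)))
      (Set.uIcc 0 (2 * Real.pi)) := by
    intro φ hφ
    rw [Set.uIcc_of_le Real.two_pi_pos.le] at hφ
    simp only [sinh_signedDist, (h φ hφ).1.lineFn_eq]
  have h2 : Set.EqOn (fun φ => supportFn O K (θ₀ + φ))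
      (fun φ => Real.sinh (dist O (P φ)) * Real.cos (α φ)) (Set.uIcc 0 (2 * Real.pi)) := by
    intro φ hφ
    rw [Set.uIcc_of_le Real.two_pi_pos.le] at hφ
    simp only [← lineFn_of_isNormalAngle (h φ hφ).2, (h φ hφ).1.lineFn_eq]
  have hint : IntervalIntegrable (fun φ => supportFn O K (θ₀ + φ)) MeasureTheory.volume 0 (2 * Real.pi) :=
    ((continuous_supportFn O hcompact).comp (continuous_const.add continuous_id)).intervalIntegrable _ _
  have hper := (toReal_perimeter O hcompact hne).trans (integral_supportFn_add O K θ₀).symm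
  exact ⟨hint.congr (h1.mono Set.uIoc_subset_uIcc), hint.congr (h2.mono Set.uIoc_subset_uIcc),
    hper.trans (intervalIntegral.integral_congr h1), hper.trans (intervalIntegral.integral_congr h2)⟩
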